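/- Let $\mathcal F$ be a finite family of finite sets that is union-closed, i.e. $A,B\in\mathcal F$ implies $A\cup B\in\mathcal F$, and suppose that its ground set $\bigcup_{A\in\mathcal F}A$ has at least $2$ elements. List the elements of the ground set in decreasing order of the number of members of $\mathcal F$ that contain them, and let $f_2(\mathcal F)$ be the proportion of the members of $\mathcal F$ that contain the second element of this list. Call $\mathcal F$ a near-$2$-cube if $\mathcal F=\{\varnothing,\{x\},U\}$ for some element $x$ and some finite set $U\supsetneq\{x\}$. For a most frequent element $x$ of the ground set, call a finite set $S$ $2$-good (with respect to $x$) if $x\notin S$ and $S\cap A\neq\varnothing$ for every $A\in\mathcal F$ other than $\varnothing$ and $\{x\}$; a $2$-good set is minimal if none of its proper subsets is $2$-good. If $\mathcal F$ is not a near-$2$-cube and $f_2(\mathcal F)\le\frac13$, then (i) $81\le|\mathcal F|\le 113$, and (ii) for every choice of a most frequent element $x$, every minimal $2$-good set with respect to $x$ has exactly $4$ elements. -/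

import Mathlib

open Finset

/-- The ground set `⋃ F` of a finite family of finite sets. -/
def groundSet {α : Type*} [DecidableEq α] (F : Finset (Finset α)) : Finset α :=
  F.biUnion id

/-- The number of sets of `F` that contain `x`. -/
def setCount {α : Type*} [DecidableEq α] (F : Finset (Finset α)) (x : α) : ℕ :=
  #{A ∈ F | x ∈ A}

/-- The counts of the elements of the ground set, with multiplicity, in decreasing order. -/
def sortedCounts {α : Type*} [DecidableEq α] (F : Finset (Finset α)) : List ℕ :=
  ((groundSet F).val.map (setCount F)).sort (· ≥ ·)

/-- The proportion `f_k(F)` of the sets of `F` that contain the `k`-th most frequent element of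
the ground set (`1 ≤ k ≤ #(groundSet F)`; ties are counted with multiplicity). -/
def kthFrequency {α : Type*} [DecidableEq α] (k : ℕ) (F : Finset (Finset α)) : ℚ :=
  ((sortedCounts F).getD (k - 1) 0 : ℚ) / (#F : ℚ)

/-- `F` is a near-2-cube: the power set `{∅, {x}}` of a one-element set together with one further
set `U` that properly contains `{x}`. -/
def IsNearTwoCube {α : Type*} [DecidableEq α] (F : Finset (Finset α)) : Prop :=
  ∃ (x : α) (U : Finset α), {x} ⊂ U ∧ F = {∅, {x}, U}

/-- `x` is a most frequent element of the ground set of `F`. -/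
def IsMostFrequent {α : Type*} [DecidableEq α] (F : Finset (Finset α)) (x : α) : Prop :=
  x ∈ groundSet F ∧ ∀ y ∈ groundSet F, setCount F y ≤ setCount F x

/-- `S` is 2-good for `F`, where `x` is the chosen most frequent element: `S` avoids `x` and meets
every set of `F` other than `∅` and `{x}`. -/
def IsTwoGood {α : Type*} [DecidableEq α] (F : Finset (Finset α)) (x : α) (S : Finset α) : Prop :=
  x ∉ S ∧ ∀ A ∈ F, A ≠ ∅ → A ≠ {x} → S ∩ A ≠ ∅

/-- `S` is a minimal 2-good set: no proper subset of `S` is 2-good. -/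
def IsMinimalTwoGood {α : Type*} [DecidableEq α] (F : Finset (Finset α)) (x : α)
    (S : Finset α) : Prop :=
  IsTwoGood F x S ∧ ∀ T : Finset α, T ⊂ S → ¬ IsTwoGood F x T

/-! Fix a most frequent element `x`; every other element then has frequency at most `1 / 3`. Two
independent arguments meet at the number `113`.

The upper bound is an entropy argument. Let `A`, `B` be independent uniform members and reveal their
elements one at a time, `x` first. By `binEntropy_mul_ge`, revealing `i` in `A ∪ B` gains at least
`8 / 5 * P(i ∉ A)` times the entropy gained in `A` (`traceEntropy_union_insert_ge`). For `i ≠ x`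
this factor is at least `16 / 15 > 1`, while `A ∪ B` lies in `F` and so has entropy at most `log
#F`. The surplus bounds `log #F` by the contribution of `x`. To reach `113`, either all frequencies
off `x` are at most `8 / 25` and the factor improves, or some `y` has frequency near `1 / 3`; then
`y` is much more frequent in `A ∪ B` than in `A`, so `A ∪ B` is far from uniform and its entropy is
well below `log #F`.

The lower bound is a double count over a minimal 2-good set of size `s`. Minimality gives members
meeting it in each single point, so by union-closure every nonempty subset is a trace; the empty
trace occurs at most twice. Frequencies of at most `1 / 3` bound the incidences, which yields `3 * ∑
(|T| - 1) * m T + 3n ≤ s * n + 6` for any lower bounds `m` on the trace multiplicities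
(`weight_univ_le`). With `m = 1` this excludes `s = 3` and gives `n ≥ 127` for `s = 6`; `s = 2`
needs one more count, `s = 1` is a near-2-cube, and `s ≥ 7` has too many traces.

For `s = 4, 5` multiplicities must be shown to exceed one. An element `w ≠ x` separating two members
of trace `{i}` doubles every trace that contains `i` and avoids the indices where `w` is forced. If
`w` is forced at two indices, it can replace both points, and the smaller count makes that pair's
trace very frequent. If it is forced at one index, it can be exchanged for that point. This gives `n
≥ 81` for `s = 4` and `n ≥ 114` for `s = 5`. -/

/-! ### Inequalities for logarithms and binary entropy. -/

lemma two_mul_sum_le_log_one_add_div_one_sub {z : ℝ} (h₀ : 0 ≤ z) (h₁ : z < 1) :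
    2 * (z + z ^ 3 / 3 + z ^ 5 / 5) ≤ Real.log ((1 + z) / (1 - z)) := by
  have h := Real.sum_range_le_log_div h₀ h₁ 3
  norm_num [Finset.sum_range_succ] at h
  linarith

lemma two_mul_le_log_one_add_div_one_sub {z : ℝ} (h₀ : 0 ≤ z) (h₁ : z < 1) :
    2 * z ≤ Real.log ((1 + z) / (1 - z)) := by
  have h := Real.sum_range_le_log_div h₀ h₁ 1
  norm_num [Finset.sum_range_succ] at h
  linarith

/-- The right-hand side is a Padé approximant of `log (1 + t)`, exact to third order at `0`; the
difference vanishes at `0` and has nonnegative derivative. -/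
lemma log_one_add_le_div {t : ℝ} (h : 0 ≤ t) :
    Real.log (1 + t) ≤ t * (6 + t) / (6 + 4 * t) := by
  let f : ℝ → ℝ := fun s => s * (6 + s) / (6 + 4 * s) - Real.log (1 + s)
  have hd : ∀ s : ℝ, 0 ≤ s → HasDerivAt f
      (((1 * (6 + s) + s * 1) * (6 + 4 * s) - s * (6 + s) * (4 * 1)) / (6 + 4 * s) ^ 2
        - 1 / (1 + s)) s := by
    intro s hs
    have h1 : HasDerivAt (fun s : ℝ => s * (6 + s)) (1 * (6 + s) + s * 1) s :=
      (hasDerivAt_id s).mul ((hasDerivAt_id s).const_add 6)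
    have h2 : HasDerivAt (fun s : ℝ => 6 + 4 * s) (4 * 1) s :=
      ((hasDerivAt_id s).const_mul 4).const_add 6
    have h3 : HasDerivAt (fun s : ℝ => Real.log (1 + s)) (1 / (1 + s)) s :=
      ((hasDerivAt_id s).const_add 1).log (by simp only [id]; positivity)
    exact (h1.div h2 (by positivity)).sub h3
  have hmono : MonotoneOn f (Set.Ici 0) := by
    apply monotoneOn_of_hasDerivWithinAt_nonneg (convex_Ici 0)
      (fun s hs => (hd s hs).continuousAt.continuousWithinAt)
      (fun s hs => (hd s (interior_subset hs)).hasDerivWithinAt)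
    intro s hs
    have hs : 0 ≤ s := interior_subset hs
    rw [sub_nonneg, div_le_div_iff₀ (by positivity) (by positivity)]
    nlinarith [pow_nonneg hs 3]
  have := hmono (Set.mem_Ici.2 le_rfl) (Set.mem_Ici.2 h) h
  simp only [f] at this
  norm_num at this
  linarith

/-- The diagonal case of `binEntropy_mul_ge`. -/
lemma binEntropy_sq_ge {t : ℝ} (h₀ : 0 < t) (h₁ : t < 1) :
    8 / 5 * (t * Real.binEntropy t) ≤ Real.binEntropy (t ^ 2) := by
  have ha : 2 * ((1 - t) / (1 + t)) ≤ -Real.log t := by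
    have h := two_mul_le_log_one_add_div_one_sub (z := (1 - t) / (1 + t))
      (div_nonneg (by linarith) (by linarith)) (by rw [div_lt_one (by linarith)]; linarith)
    have e : (1 + (1 - t) / (1 + t)) / (1 - (1 - t) / (1 + t)) = t⁻¹ := by
      have h1 : 1 - (1 - t) / (1 + t) = 2 * t / (1 + t) := by field_simp; ring
      have h2 : 1 + (1 - t) / (1 + t) = 2 / (1 + t) := by field_simp; ring
      rw [h1, h2]; field_simp
    rwa [e, Real.log_inv] at h
  have hb : 2 * (t / (2 - t) + (t / (2 - t)) ^ 3 / 3 + (t / (2 - t)) ^ 5 / 5)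
      ≤ -Real.log (1 - t) := by
    have h := two_mul_sum_le_log_one_add_div_one_sub (z := t / (2 - t))
      (div_nonneg (by linarith) (by linarith)) (by rw [div_lt_one (by linarith)]; linarith)
    have e : (1 + t / (2 - t)) / (1 - t / (2 - t)) = (1 - t)⁻¹ := by
      have h0 : 2 - t ≠ 0 := by linarith
      have h3 : 1 - t ≠ 0 := by linarith
      have h1 : 1 - t / (2 - t) = 2 * (1 - t) / (2 - t) := by field_simp; ring
      have h2 : 1 + t / (2 - t) = 2 / (2 - t) := by field_simp; ring
      rw [h1, h2]; field_simp
    rwa [e, Real.log_inv] at h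
  have hc := log_one_add_le_div h₀.le
  have hl : Real.log (1 - t ^ 2) = Real.log (1 - t) + Real.log (1 + t) := by
    rw [← Real.log_mul (by linarith) (by linarith)]; ring_nf
  -- In the entropy inequality `-log t` has coefficient `(2 - 8 / 5) * t ^ 2` and `-log (1 - t)` has
  -- `(1 - t) * (1 - 3 / 5 * t)`. With the rational bounds inserted, the numerator has only positive
  -- coefficients in the products of powers of `t` and `1 - t`.
  have key : (1 - t ^ 2) * (t * (6 + t) / (6 + 4 * t)) ≤
      2 / 5 * t ^ 2 * (2 * ((1 - t) / (1 + t))) + (1 - t) * (1 - 3 / 5 * t) *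
        (2 * (t / (2 - t) + (t / (2 - t)) ^ 3 / 3 + (t / (2 - t)) ^ 5 / 5)) := by
    have h2 : 0 < 2 - t := by linarith
    have h3 : 0 < 1 - t := by linarith
    rw [← sub_nonneg]
    have e : 2 / 5 * t ^ 2 * (2 * ((1 - t) / (1 + t))) + (1 - t) * (1 - 3 / 5 * t) *
        (2 * (t / (2 - t) + (t / (2 - t)) ^ 3 / 3 + (t / (2 - t)) ^ 5 / 5))
        - (1 - t ^ 2) * (t * (6 + t) / (6 + 4 * t)) =
        t ^ 2 * (1 - t) * (2880 * (1 - t) ^ 7 + 9120 * t * (1 - t) ^ 6 + 9200 * t ^ 2 * (1 - t) ^ 5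
          + 3640 * t ^ 3 * (1 - t) ^ 4 + 2012 * t ^ 4 * (1 - t) ^ 3 + 2791 * t ^ 5 * (1 - t) ^ 2
          + 1724 * t ^ 6 * (1 - t) + 340 * t ^ 7) / (75 * (1 + t) * (2 - t) ^ 5 * (6 + 4 * t)) := by
      field_simp
      ring
    rw [e]
    positivity
  have hd : (1 - t ^ 2) * Real.log (1 + t) ≤ (1 - t ^ 2) * (t * (6 + t) / (6 + 4 * t)) :=
    mul_le_mul_of_nonneg_left hc (by nlinarith)
  have ha' := mul_le_mul_of_nonneg_left ha (show 0 ≤ 2 / 5 * t ^ 2 by positivity)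
  have hb' := mul_le_mul_of_nonneg_left hb
    (show 0 ≤ (1 - t) * (1 - 3 / 5 * t) from mul_nonneg (by linarith) (by linarith))
  simp only [Real.binEntropy, Real.log_inv, hl, Real.log_pow]
  push_cast
  nlinarith

/-- These are slopes of chords of the concave function `log` with one end at `1`. -/
lemma neg_log_one_sub_div_mono {s t : ℝ} (hs : 0 < s) (hst : s ≤ t) (ht : t < 1) :
    -Real.log (1 - s) / s ≤ -Real.log (1 - t) / t := by
  have hc := strictConcaveOn_log_Ioi.concaveOn
  have hst' : 0 ≤ 1 - s / t := sub_nonneg.2 ((div_le_one (by linarith)).2 hst)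
  have h := hc.2 (show (1 : ℝ) ∈ Set.Ioi 0 by simp) (show 1 - t ∈ Set.Ioi 0 by simpa using ht)
    hst' (show 0 ≤ s / t by have := hs.trans_le hst; positivity) (by ring)
  have ht0 : t ≠ 0 := by linarith
  simp only [smul_eq_mul, Real.log_one, mul_zero, zero_add] at h
  have e : (1 - s / t) * 1 + s / t * (1 - t) = 1 - s := by field_simp; ring
  rw [e] at h
  rw [div_le_div_iff₀ hs (by linarith)]
  have h' := mul_le_mul_of_nonneg_right h (hs.trans_le hst).le
  have e2 : s / t * Real.log (1 - t) * t = s * Real.log (1 - t) := by field_simp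
  nlinarith

/-- The derivative is `-log (1 - t) / t` at `t = exp (-a)`, which increases in `t` and hence
decreases in `a`. This concavity reduces the two-variable entropy inequality to its diagonal. -/
lemma concaveOn_binEntropy_exp :
    ConcaveOn ℝ (Set.Ioi (0 : ℝ)) (fun a => Real.binEntropy (Real.exp (-a)) / Real.exp (-a)) := by
  have hlt : ∀ a ∈ Set.Ioi (0 : ℝ), Real.exp (-a) < 1 := fun a ha => by
    rw [Real.exp_lt_one_iff]; simpa using ha
  have hd : ∀ a ∈ Set.Ioi (0 : ℝ), HasDerivAt
      (fun a => Real.binEntropy (Real.exp (-a)) / Real.exp (-a))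
      (-Real.log (1 - Real.exp (-a)) / Real.exp (-a)) a := by
    intro a ha
    have h1 : HasDerivAt (fun a : ℝ => Real.exp (-a)) (-Real.exp (-a)) a := by
      simpa using (hasDerivAt_neg a).exp
    have h2 := (Real.hasDerivAt_binEntropy (Real.exp_pos _).ne' (hlt a ha).ne).comp a h1
    have h3 := h2.div h1 (Real.exp_pos _).ne'
    refine h3.congr_deriv ?_
    have := Real.exp_pos (-a)
    simp only [Function.comp_apply, Real.binEntropy, Real.log_inv, Real.log_exp]
    field_simp
    ring
  have hdiff : DifferentiableOn ℝ
      (fun a => Real.binEntropy (Real.exp (-a)) / Real.exp (-a)) (Set.Ioi 0) :=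
    fun a ha => (hd a ha).differentiableAt.differentiableWithinAt
  apply AntitoneOn.concaveOn_of_deriv (convex_Ioi 0) hdiff.continuousOn
  · rwa [interior_Ioi]
  · rw [interior_Ioi]
    intro a ha b hb hab
    rw [(hd a ha).deriv, (hd b hb).deriv]
    exact neg_log_one_sub_div_mono (Real.exp_pos _) (by simpa using hab) (hlt a ha)

/-- A lower bound for the entropy of the conjunction of two independent bits. -/
lemma binEntropy_mul_ge {p q : ℝ} (hp₀ : 0 ≤ p) (hp₁ : p ≤ 1) (hq₀ : 0 ≤ q) (hq₁ : q ≤ 1) :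
    4 / 5 * (p * Real.binEntropy q + q * Real.binEntropy p) ≤ Real.binEntropy (p * q) := by
  have hnp := Real.binEntropy_nonneg hp₀ hp₁
  have hnq := Real.binEntropy_nonneg hq₀ hq₁
  rcases hp₀.eq_or_lt with rfl | hp₀
  · simp
  rcases hq₀.eq_or_lt with rfl | hq₀
  · simp
  rcases hp₁.eq_or_lt with rfl | hp₁
  · simp; linarith
  rcases hq₁.eq_or_lt with rfl | hq₁
  · simp; linarith
  have hlp := Real.log_neg hp₀ hp₁
  have hlq := Real.log_neg hq₀ hq₁
  have hc := concaveOn_binEntropy_exp.2 (show -Real.log p ∈ Set.Ioi 0 by simpa using hlp)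
    (show -Real.log q ∈ Set.Ioi 0 by simpa using hlq) (show (0 : ℝ) ≤ 1 / 2 by norm_num)
    (show (0 : ℝ) ≤ 1 / 2 by norm_num) (by norm_num)
  simp only [neg_neg, Real.exp_log hp₀, Real.exp_log hq₀, smul_eq_mul] at hc
  -- `t` is the geometric mean of `p` and `q`, the midpoint in the logarithmic variable.
  set t := Real.exp (-(1 / 2 * -Real.log p + 1 / 2 * -Real.log q)) with ht
  have ht2 : t ^ 2 = p * q := by
    rw [ht, ← Real.exp_nat_mul]
    push_cast
    rw [show 2 * -(1 / 2 * -Real.log p + 1 / 2 * -Real.log q) = Real.log p + Real.log q by ring,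
      Real.exp_add, Real.exp_log hp₀, Real.exp_log hq₀]
  have ht0 : 0 < t := Real.exp_pos _
  have ht1 : t < 1 := by
    rw [ht, Real.exp_lt_one_iff]
    linarith
  have h := binEntropy_sq_ge ht0 ht1
  rw [ht2] at h
  refine le_trans ?_ h
  have hc' := mul_le_mul_of_nonneg_right hc (show 0 ≤ 2 * t ^ 2 by positivity)
  have e1 : Real.binEntropy t / t * (2 * t ^ 2) = 2 * (t * Real.binEntropy t) := by
    field_simp
  have e2 : (1 / 2 * (Real.binEntropy p / p) + 1 / 2 * (Real.binEntropy q / q)) * (2 * t ^ 2)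
      = p * Real.binEntropy q + q * Real.binEntropy p := by
    rw [ht2]; field_simp; ring
  rw [e1, e2] at hc'
  linarith

/-- The two-outcome entropy increment `m h(u / m)` in terms of `negMulLog`. -/
lemma negMulLog_add_sub_eq {m u : ℝ} (hu : 0 ≤ u) (hum : u ≤ m) :
    Real.negMulLog u + Real.negMulLog (m - u) - Real.negMulLog m
      = m * Real.binEntropy (u / m) := by
  rcases hu.eq_or_lt with rfl | hu
  · simp
  rcases hum.eq_or_lt with rfl | hum
  · simp [hu.ne']
  have hm : 0 < m := hu.trans hum
  have e : 1 - u / m = (m - u) / m := by field_simp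
  have hmu : m - u ≠ 0 := by linarith
  simp only [Real.negMulLog, Real.binEntropy, e, Real.log_inv, Real.log_div hu.ne' hm.ne',
    Real.log_div hmu hm.ne']
  field_simp
  ring

/-- Jensen for the concave binary entropy with weights `m i`: merging conditioning events cannot
lower conditional entropy. -/
lemma sum_mul_binEntropy_le {ι : Type*} (s : Finset ι) (m u : ι → ℝ) (hu : ∀ i ∈ s, 0 ≤ u i)
    (hum : ∀ i ∈ s, u i ≤ m i) :
    ∑ i ∈ s, m i * Real.binEntropy (u i / m i)
      ≤ (∑ i ∈ s, m i) * Real.binEntropy ((∑ i ∈ s, u i) / ∑ i ∈ s, m i) := by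
  have hm : ∀ i ∈ s, 0 ≤ m i := fun i hi => (hu i hi).trans (hum i hi)
  rcases (sum_nonneg hm).eq_or_lt with h0 | hpos
  · rw [← h0, zero_mul]
    refine (sum_eq_zero fun i hi => ?_).le
    rw [(sum_eq_zero_iff_of_nonneg hm).1 h0.symm i hi, zero_mul]
  · have hJ := Real.strictConcave_binEntropy.concaveOn.le_map_sum (t := s)
      (w := fun i => m i / ∑ j ∈ s, m j) (p := fun i => u i / m i)
      (fun i hi => div_nonneg (hm i hi) hpos.le) (by rw [← sum_div, div_self hpos.ne'])
      (fun i hi => ⟨div_nonneg (hu i hi) (hm i hi), div_le_one_of_le₀ (hum i hi) (hm i hi)⟩)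
    simp only [smul_eq_mul] at hJ
    have e : ∑ i ∈ s, m i / (∑ j ∈ s, m j) * (u i / m i) = (∑ i ∈ s, u i) / ∑ i ∈ s, m i := by
      rw [sum_div]
      refine sum_congr rfl fun i hi => ?_
      rcases (hm i hi).eq_or_lt with h | h
      · have : u i = 0 := le_antisymm (h ▸ hum i hi) (hu i hi)
        simp [← h, this]
      · field_simp
    rw [e] at hJ
    calc ∑ i ∈ s, m i * Real.binEntropy (u i / m i)
        = (∑ i ∈ s, m i) * ∑ i ∈ s, m i / (∑ j ∈ s, m j) * Real.binEntropy (u i / m i) := by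
          rw [mul_sum]
          refine sum_congr rfl fun i _ => ?_
          field_simp
      _ ≤ _ := mul_le_mul_of_nonneg_left hJ hpos.le

lemma mul_binEntropy_mul_ge {m u m' u' : ℝ} (hu : 0 ≤ u) (hum : u ≤ m) (hu' : 0 ≤ u')
    (hum' : u' ≤ m') :
    4 / 5 * (u * (m' * Real.binEntropy (u' / m')) + u' * (m * Real.binEntropy (u / m)))
      ≤ m * m' * Real.binEntropy (u * u' / (m * m')) := by
  have hm := hu.trans hum
  have hm' := hu'.trans hum'
  have h := mul_le_mul_of_nonneg_left (binEntropy_mul_ge (div_nonneg hu hm)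
    (div_le_one_of_le₀ hum hm) (div_nonneg hu' hm') (div_le_one_of_le₀ hum' hm'))
    (mul_nonneg hm hm')
  rw [div_mul_div_comm] at h
  refine le_of_eq_of_le ?_ h
  rcases hm.eq_or_lt with h0 | h0
  · have : u = 0 := le_antisymm (h0 ▸ hum) hu
    simp [← h0, this]
  rcases hm'.eq_or_lt with h1 | h1
  · have : u' = 0 := le_antisymm (h1 ▸ hum') hu'
    simp [← h1, this]
  field_simp

lemma sum_mul_sum_binEntropy_le {ι : Type*} (s : Finset ι) (m u : ι → ℝ)
    (hu : ∀ i ∈ s, 0 ≤ u i) (hum : ∀ i ∈ s, u i ≤ m i) :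
    8 / 5 * (∑ a ∈ s, u a) * ∑ a ∈ s, m a * Real.binEntropy (u a / m a)
      ≤ ∑ p ∈ s ×ˢ s, m p.1 * m p.2 * Real.binEntropy (u p.1 * u p.2 / (m p.1 * m p.2)) := by
  calc 8 / 5 * (∑ a ∈ s, u a) * ∑ a ∈ s, m a * Real.binEntropy (u a / m a)
      = ∑ p ∈ s ×ˢ s, 4 / 5 * (u p.1 * (m p.2 * Real.binEntropy (u p.2 / m p.2))
            + u p.2 * (m p.1 * Real.binEntropy (u p.1 / m p.1))) := by
        rw [← mul_sum, sum_add_distrib,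
          sum_product' s s fun a b => u a * (m b * Real.binEntropy (u b / m b)),
          sum_product_right' s s fun a b => u b * (m a * Real.binEntropy (u a / m a)),
          ← sum_mul_sum]
        ring
    _ ≤ _ := by
        refine sum_le_sum fun p hp => ?_
        obtain ⟨h1, h2⟩ := mem_product.1 hp
        exact mul_binEntropy_mul_ge (hu _ h1) (hum _ h1) (hu _ h2) (hum _ h2)

/-! ### Entropy of the trace of a random set, and of a union of two. -/

section Law

variable {α β : Type*} [DecidableEq α]

/-- The law of `f ω ∩ S` for `ω` uniform in `Ω`. -/
noncomputable def traceLaw (Ω : Finset β) (f : β → Finset α) (S a : Finset α) : ℝ :=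
  (#{ω ∈ Ω | f ω ∩ S = a} : ℝ) / #Ω

/-- The entropy of `f ω ∩ S` for `ω` uniform in `Ω`. -/
noncomputable def traceEntropy (Ω : Finset β) (f : β → Finset α) (S : Finset α) : ℝ :=
  ∑ a ∈ S.powerset, Real.negMulLog (traceLaw Ω f S a)

lemma traceLaw_nonneg (Ω : Finset β) (f : β → Finset α) (S a : Finset α) :
    0 ≤ traceLaw Ω f S a := by
  unfold traceLaw; positivity

lemma inter_insert_eq_iff {A S a : Finset α} {i : α} (hi : i ∉ S) (ha : a ⊆ S) :
    (A ∩ insert i S = a ↔ A ∩ S = a ∧ i ∉ A) ∧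
      (A ∩ insert i S = insert i a ↔ A ∩ S = a ∧ i ∈ A) := by
  have hia : i ∉ a := fun h => hi (ha h)
  by_cases hA : i ∈ A
  · rw [inter_insert_of_mem hA]
    have hiS : i ∉ A ∩ S := fun h => hi (mem_inter.1 h).2
    refine ⟨⟨fun h => absurd (h ▸ mem_insert_self _ _) hia, fun h => absurd hA h.2⟩,
      fun h => ⟨?_, hA⟩, fun h => by rw [h.1]⟩
    rw [← erase_insert hiS, h, erase_insert hia]
  · rw [inter_insert_of_notMem hA]
    refine ⟨⟨fun h => ⟨h, hA⟩, fun h => h.1⟩, fun h => ?_, fun h => absurd h.2 hA⟩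
    have : i ∈ A ∩ S := h ▸ mem_insert_self _ _
    exact absurd (mem_inter.1 this).1 hA

lemma traceLaw_insert_add (Ω : Finset β) (f : β → Finset α) {S a : Finset α} {i : α}
    (hi : i ∉ S) (ha : a ⊆ S) :
    traceLaw Ω f (insert i S) a + traceLaw Ω f (insert i S) (insert i a) = traceLaw Ω f S a := by
  unfold traceLaw
  rw [← add_div, ← Nat.cast_add]
  congr 2
  rw [filter_congr fun ω _ => (inter_insert_eq_iff (A := f ω) hi ha).1,
    filter_congr fun ω _ => (inter_insert_eq_iff (A := f ω) hi ha).2,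
    ← filter_filter, ← filter_filter, add_comm]
  exact card_filter_add_card_filter_not _

lemma traceLaw_insert_le (Ω : Finset β) (f : β → Finset α) {S a : Finset α} {i : α}
    (hi : i ∉ S) (ha : a ⊆ S) : traceLaw Ω f (insert i S) a ≤ traceLaw Ω f S a := by
  have := traceLaw_insert_add Ω f hi ha
  have := traceLaw_nonneg Ω f (insert i S) (insert i a)
  linarith

/-- The chain rule for one additional coordinate. -/
lemma traceEntropy_insert (Ω : Finset β) (f : β → Finset α) {S : Finset α} {i : α} (hi : i ∉ S) :
    traceEntropy Ω f (insert i S) = traceEntropy Ω f S + ∑ a ∈ S.powerset,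
      traceLaw Ω f S a * Real.binEntropy (traceLaw Ω f (insert i S) a / traceLaw Ω f S a) := by
  unfold traceEntropy
  rw [sum_powerset_insert hi, ← sum_add_distrib, ← sum_add_distrib]
  refine sum_congr rfl fun a ha => ?_
  have ha := mem_powerset.1 ha
  rw [← negMulLog_add_sub_eq (traceLaw_nonneg _ _ _ _) (traceLaw_insert_le Ω f hi ha),
    show traceLaw Ω f (insert i S) (insert i a)
      = traceLaw Ω f S a - traceLaw Ω f (insert i S) a by
        linarith [traceLaw_insert_add Ω f hi ha]]
  ring

lemma traceEntropy_le_insert (Ω : Finset β) (f : β → Finset α) {S : Finset α} {i : α}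
    (hi : i ∉ S) : traceEntropy Ω f S ≤ traceEntropy Ω f (insert i S) := by
  rw [traceEntropy_insert Ω f hi]
  refine le_add_of_nonneg_right (sum_nonneg fun a ha => ?_)
  have ha := mem_powerset.1 ha
  have h0 := traceLaw_nonneg Ω f S a
  exact mul_nonneg h0 (Real.binEntropy_nonneg (div_nonneg (traceLaw_nonneg _ _ _ _) h0)
    (div_le_one_of_le₀ (traceLaw_insert_le Ω f hi ha) h0))

lemma sum_traceLaw_insert (Ω : Finset β) (f : β → Finset α) {S : Finset α} {i : α} (hi : i ∉ S) :
    ∑ a ∈ S.powerset, traceLaw Ω f (insert i S) a = (#{ω ∈ Ω | i ∉ f ω} : ℝ) / #Ω := by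
  unfold traceLaw
  rw [← sum_div, ← Nat.cast_sum]
  congr 2
  rw [card_eq_sum_card_fiberwise (f := fun ω => f ω ∩ S) (t := S.powerset)
    (fun ω _ => by simp)]
  refine sum_congr rfl fun a ha => ?_
  rw [filter_filter]
  congr 1
  refine filter_congr fun ω _ => ?_
  rw [(inter_insert_eq_iff hi (mem_powerset.1 ha)).1, and_comm]

lemma traceLaw_union (F : Finset (Finset α)) {S S' c : Finset α} (hc : c ⊆ S) :
    traceLaw (F ×ˢ F) (fun p => p.1 ∪ p.2) S' c
      = ∑ p ∈ (S.powerset ×ˢ S.powerset) with p.1 ∪ p.2 = c,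
          traceLaw F id S' p.1 * traceLaw F id S' p.2 := by
  unfold traceLaw
  simp only [id, card_product, Nat.cast_mul, div_mul_div_comm]
  rw [← sum_div]
  simp only [← Nat.cast_mul]
  rw [← Nat.cast_sum]
  congr 2
  rw [card_eq_sum_card_fiberwise (f := fun p : Finset α × Finset α => (p.1 ∩ S', p.2 ∩ S'))
    (t := (S.powerset ×ˢ S.powerset).filter fun p => p.1 ∪ p.2 = c)]
  · refine sum_congr rfl fun p hp => ?_
    rw [← card_product]
    congr 1
    ext ⟨A, B⟩
    have hp := (mem_filter.1 hp).2
    simp only [mem_filter, mem_product, Prod.ext_iff, union_inter_distrib_right]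
    constructor
    · rintro ⟨⟨⟨hA, hB⟩, _⟩, h1, h2⟩
      exact ⟨⟨hA, h1⟩, hB, h2⟩
    · rintro ⟨⟨hA, h1⟩, hB, h2⟩
      exact ⟨⟨⟨hA, hB⟩, by rw [h1, h2, hp]⟩, h1, h2⟩
  · rintro ⟨A, B⟩ h
    have h := (mem_filter.1 h).2
    simp only [union_inter_distrib_right] at h
    simp only [coe_filter, mem_product, mem_powerset, Set.mem_ofPred_eq]
    exact ⟨⟨(subset_union_left.trans h.subset).trans hc,
      (subset_union_right.trans h.subset).trans hc⟩, h⟩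

/-- One coordinate of the union of two independent members carries at least
`8 / 5 * P(i ∉ A)` times the entropy of that coordinate of one member. -/
lemma traceEntropy_union_insert_ge (F : Finset (Finset α)) {S : Finset α} {i : α} (hi : i ∉ S) :
    8 / 5 * ((#{A ∈ F | i ∉ A} : ℝ) / #F) *
        (traceEntropy F id (insert i S) - traceEntropy F id S)
      ≤ traceEntropy (F ×ˢ F) (fun p => p.1 ∪ p.2) (insert i S)
        - traceEntropy (F ×ˢ F) (fun p => p.1 ∪ p.2) S := by
  have hsum := sum_traceLaw_insert F id hi
  simp only [id] at hsum
  rw [traceEntropy_insert _ _ hi, traceEntropy_insert _ _ hi, add_sub_cancel_left,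
    add_sub_cancel_left, ← hsum]
  have hu : ∀ a ∈ S.powerset, 0 ≤ traceLaw F id (insert i S) a :=
    fun a _ => traceLaw_nonneg _ _ _ _
  have hum : ∀ a ∈ S.powerset, traceLaw F id (insert i S) a ≤ traceLaw F id S a := fun a ha =>
    traceLaw_insert_le F id hi (mem_powerset.1 ha)
  -- Given the pair of traces of `A` and `B`, the events `i ∉ A` and `i ∉ B` are independent, so the
  -- product inequality applies. Grouping pairs by their union then passes to the coarser
  -- conditioning, by Jensen.
  refine (sum_mul_sum_binEntropy_le _ _ _ hu hum).trans ?_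
  rw [← sum_fiberwise_of_maps_to (s := S.powerset ×ˢ S.powerset) (t := S.powerset)
    (g := fun p => p.1 ∪ p.2)]
  · refine sum_le_sum fun c hc => ?_
    rw [traceLaw_union F (mem_powerset.1 hc), traceLaw_union F (mem_powerset.1 hc)]
    generalize traceLaw F id (insert i S) = u at *
    generalize traceLaw F id S = m at *
    have hu' : ∀ p : Finset α × Finset α,
        p ∈ (S.powerset ×ˢ S.powerset).filter (fun p => p.1 ∪ p.2 = c) →
        0 ≤ u p.1 * u p.2 := fun p hp =>
      mul_nonneg (hu _ (mem_product.1 (mem_filter.1 hp).1).1)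
        (hu _ (mem_product.1 (mem_filter.1 hp).1).2)
    refine sum_mul_binEntropy_le _ (fun p : Finset α × Finset α => m p.1 * m p.2)
      (fun p => u p.1 * u p.2) hu' ?_
    intro p hp
    obtain ⟨h1, h2⟩ := mem_product.1 (mem_filter.1 hp).1
    exact mul_le_mul (hum _ h1) (hum _ h2) (hu _ h2) ((hu _ h1).trans (hum _ h1))
  · intro p hp
    obtain ⟨h1, h2⟩ := mem_product.1 hp
    exact mem_powerset.2 (union_subset (mem_powerset.1 h1) (mem_powerset.1 h2))

end Law

/-! ### Numerical estimates. -/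

lemma negMulLog_le_of_pos {v q : ℝ} (hv : 0 ≤ v) (hq : 0 < q) :
    Real.negMulLog v ≤ -(v * Real.log q) + (q - v) := by
  rcases hv.eq_or_lt with rfl | hv
  · simpa using hq.le
  have h := mul_le_mul_of_nonneg_left (Real.log_le_sub_one_of_pos (div_pos hq hv)) hv.le
  rw [Real.log_div hq.ne' hv.ne', mul_sub, mul_sub, mul_div_cancel₀ _ hv.ne'] at h
  simp only [Real.negMulLog]
  linarith

lemma log_four_thirds_lt : Real.log (4 / 3) < 0.2878 := by
  have h := Real.log_div_le_sum_range_add (x := 1 / 7) (by norm_num) (by norm_num) 2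
  norm_num [Finset.sum_range_succ] at h
  linarith

lemma log_three_halves_lt : Real.log (3 / 2) < 0.4061 := by
  have h := Real.log_div_le_sum_range_add (x := 1 / 5) (by norm_num) (by norm_num) 2
  norm_num [Finset.sum_range_succ] at h
  linarith

lemma lt_log_five_thirds : 0.5108 < Real.log (5 / 3) := by
  have h := Real.sum_range_le_log_div (x := 1 / 4) (by norm_num) (by norm_num) 3
  norm_num [Finset.sum_range_succ] at h
  linarith

lemma lt_log_114 : 4.7358 < Real.log 114 := by
  have h := Real.log_div_le_sum_range_add (x := 7 / 121) (by norm_num) (by norm_num) 1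
  norm_num [Finset.sum_range_succ] at h
  have h2 := Real.log_two_gt_d9
  have e : Real.log 114 = 7 * Real.log 2 - Real.log (64 / 57) := by
    rw [show (114 : ℝ) = 2 ^ 7 / (64 / 57) by norm_num, Real.log_div (by norm_num) (by norm_num),
      Real.log_pow]
    push_cast; ring
  linarith

/-- This is, up to rounding, the tangent line at `1 / 4`, namely `log (4 / 3) + q * log 3`, obtained
from Gibbs' inequality against `(1 / 4, 3 / 4)`. -/
lemma binEntropy_le_affine {q : ℝ} (h₀ : 0 ≤ q) (h₁ : q ≤ 1) :
    Real.binEntropy q ≤ 0.2878 + 1.0986 * q := by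
  have h1 := negMulLog_le_of_pos h₀ (show (0 : ℝ) < 1 / 4 by norm_num)
  have h2 := negMulLog_le_of_pos (sub_nonneg.2 h₁) (show (0 : ℝ) < 3 / 4 by norm_num)
  have e1 : Real.log (1 / 4) = -(2 * Real.log 2) := by
    rw [show (1 / 4 : ℝ) = (2 ^ 2)⁻¹ by norm_num, Real.log_inv, Real.log_pow]; push_cast; ring
  have e2 : Real.log (3 / 4) = -Real.log (4 / 3) := by
    rw [← Real.log_inv]; norm_num
  rw [e1] at h1
  rw [e2] at h2
  have h3 := Real.log_two_lt_d9
  have h4 := log_four_thirds_lt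
  rw [Real.binEntropy_eq_negMulLog_add_negMulLog_one_sub]
  nlinarith

lemma affine_mul_binEntropy_le {c K q : ℝ} (hK : 0 ≤ K) (h₀ : 0 ≤ q) (h₁ : q ≤ 1)
    (h : ∀ s : ℝ, (c - 8 / 5 * s) * (0.2878 + 1.0986 * s) ≤ K) :
    (c - 8 / 5 * q) * Real.binEntropy q ≤ K := by
  have hb := Real.binEntropy_nonneg h₀ h₁
  rcases le_total (c - 8 / 5 * q) 0 with hc | hc
  · exact (mul_nonpos_of_nonpos_of_nonneg hc hb).trans hK
  · exact (mul_le_mul_of_nonneg_left (binEntropy_le_affine h₀ h₁) hc).trans (h q)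

/-! ### The upper bound by entropy. -/

section Family

variable {α : Type*} [DecidableEq α] {F : Finset (Finset α)}

lemma traceEntropy_empty {β : Type*} {Ω : Finset β} (hΩ : Ω.Nonempty) (f : β → Finset α) :
    traceEntropy Ω f ∅ = 0 := by
  have : (#Ω : ℝ) ≠ 0 := by exact_mod_cast hΩ.card_pos.ne'
  simp [traceEntropy, traceLaw, this]

lemma traceEntropy_singleton (hne : F.Nonempty) (x : α) :
    traceEntropy F id {x} = Real.binEntropy ((#{A ∈ F | x ∉ A} : ℝ) / #F) := by
  have hn : (#F : ℝ) ≠ 0 := by exact_mod_cast hne.card_pos.ne'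
  have h := traceEntropy_insert F id (notMem_empty x)
  have hs := sum_traceLaw_insert F id (notMem_empty x)
  simp only [powerset_empty, sum_singleton, id] at h hs
  rw [traceEntropy_empty hne, hs] at h
  have e : traceLaw F id ∅ ∅ = 1 := by simp [traceLaw, hn]
  rw [e, zero_add, one_mul, div_one] at h
  exact h

/-- Sums the one-coordinate gains along the chain rule. The frequency of `x` is not controlled, so
`x` is revealed first, where its gain is an unconditional entropy. -/
lemma traceEntropy_union_ge (hne : F.Nonempty) (x : α) {r : ℝ} (S : Finset α)
    (hx : x ∉ S) (hr : ∀ i ∈ S, r ≤ (#{A ∈ F | i ∉ A} : ℝ) / #F) :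
    8 / 5 * ((#{A ∈ F | x ∉ A} : ℝ) / #F) * traceEntropy F id {x}
        + 8 / 5 * r * (traceEntropy F id (insert x S) - traceEntropy F id {x})
      ≤ traceEntropy (F ×ˢ F) (fun p => p.1 ∪ p.2) (insert x S) := by
  induction S using Finset.induction_on with
  | empty =>
    have h := traceEntropy_union_insert_ge F (notMem_empty x)
    rw [traceEntropy_empty hne, traceEntropy_empty (hne.product hne)] at h
    simpa using h
  | insert i S hi ih =>
    have hx' : x ∉ S := fun h => hx (mem_insert_of_mem h)
    have hix : i ∉ insert x S := by
      rw [mem_insert]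
      rintro (rfl | h)
      · exact hx (mem_insert_self _ _)
      · exact hi h
    have h1 := ih hx' fun j hj => hr j (mem_insert_of_mem hj)
    have h2 := traceEntropy_union_insert_ge F hix
    have h3 := mul_le_mul_of_nonneg_right (hr i (mem_insert_self _ _))
      (sub_nonneg.2 (traceEntropy_le_insert F id hix))
    rw [insert_comm]
    nlinarith

lemma traceEntropy_groundSet (hne : F.Nonempty) :
    traceEntropy F id (groundSet F) = Real.log #F := by
  have hn : (#F : ℝ) ≠ 0 := by exact_mod_cast hne.card_pos.ne'
  have hsub : ∀ A ∈ F, A ⊆ groundSet F := fun A hA => subset_biUnion_of_mem id hA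
  have hlaw : ∀ a, traceLaw F id (groundSet F) a = if a ∈ F then (#F : ℝ)⁻¹ else 0 := by
    intro a
    have e : ({A ∈ F | id A ∩ groundSet F = a} : Finset _) = if a ∈ F then {a} else ∅ := by
      ext A
      split_ifs with h <;> simp only [mem_filter, id, mem_singleton, notMem_empty, iff_false]
      · constructor
        · rintro ⟨hA, rfl⟩
          exact (inter_eq_left.2 (hsub A hA)).symm
        · rintro rfl
          exact ⟨h, inter_eq_left.2 (hsub A h)⟩
      · rintro ⟨hA, rfl⟩
        exact h (by rwa [inter_eq_left.2 (hsub A hA)])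
    rw [traceLaw, e]
    split_ifs <;> simp
  unfold traceEntropy
  rw [← sum_subset (s₁ := F) (fun A hA => mem_powerset.2 (hsub A hA))
    (fun a _ ha => by simp [hlaw, ha]), sum_congr rfl (fun a ha => by rw [hlaw, if_pos ha])]
  rw [sum_const, nsmul_eq_mul, Real.negMulLog, Real.log_inv]
  field_simp

/-- Gibbs' inequality for the union of two independent members of a union-closed family. -/
lemma traceEntropy_union_groundSet_le (hF : ∀ A ∈ F, ∀ B ∈ F, A ∪ B ∈ F) (hne : F.Nonempty)
    (γ : Finset α → ℝ) (hγ : ∀ A ∈ F, 0 < γ A) (hsum : ∑ A ∈ F, γ A ≤ #F) :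
    traceEntropy (F ×ˢ F) (fun p => p.1 ∪ p.2) (groundSet F)
      ≤ Real.log #F - (∑ p ∈ F ×ˢ F, Real.log (γ (p.1 ∪ p.2))) / (#F : ℝ) ^ 2 := by
  have hn : (0 : ℝ) < #F := by exact_mod_cast hne.card_pos
  have hsub : ∀ A ∈ F, A ⊆ groundSet F := fun A hA => subset_biUnion_of_mem id hA
  have hmaps : ∀ p ∈ F ×ˢ F, p.1 ∪ p.2 ∈ F := fun p hp =>
    hF _ (mem_product.1 hp).1 _ (mem_product.1 hp).2
  have hlaw : ∀ a, traceLaw (F ×ˢ F) (fun p => p.1 ∪ p.2) (groundSet F) a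
      = (#{p ∈ F ×ˢ F | p.1 ∪ p.2 = a} : ℝ) / (#F : ℝ) ^ 2 := by
    intro a
    rw [traceLaw, card_product, filter_congr fun p hp => by
      rw [inter_eq_left.2 (hsub _ (hmaps p hp))]]
    push_cast
    ring
  have hzero : ∀ a ∈ (groundSet F).powerset, a ∉ F → Real.negMulLog
      (traceLaw (F ×ˢ F) (fun p => p.1 ∪ p.2) (groundSet F) a) = 0 := by
    intro a _ ha
    rw [hlaw, filter_false_of_mem fun p hp (h : p.1 ∪ p.2 = a) => ha (h ▸ hmaps p hp)]
    simp
  unfold traceEntropy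
  rw [← sum_subset (s₁ := F) (fun A hA => mem_powerset.2 (hsub A hA)) hzero]
  have hcard : ∑ a ∈ F, (#{p ∈ F ×ˢ F | p.1 ∪ p.2 = a} : ℝ) = (#F : ℝ) ^ 2 := by
    rw [← Nat.cast_sum, ← card_eq_sum_card_fiberwise hmaps, card_product]
    push_cast; ring
  have hlog : ∑ a ∈ F, (#{p ∈ F ×ˢ F | p.1 ∪ p.2 = a} : ℝ) * Real.log (γ a)
      = ∑ p ∈ F ×ˢ F, Real.log (γ (p.1 ∪ p.2)) := by
    rw [← sum_fiberwise_of_maps_to hmaps]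
    refine sum_congr rfl fun a _ => ?_
    rw [sum_congr rfl fun p hp => by rw [(mem_filter.1 hp).2], sum_const, nsmul_eq_mul]
  calc ∑ a ∈ F, Real.negMulLog (traceLaw (F ×ˢ F) (fun p => p.1 ∪ p.2) (groundSet F) a)
      ≤ ∑ a ∈ F, ((#{p ∈ F ×ˢ F | p.1 ∪ p.2 = a} : ℝ) * (Real.log #F / (#F : ℝ) ^ 2)
          - (#{p ∈ F ×ˢ F | p.1 ∪ p.2 = a} : ℝ) * Real.log (γ a) / (#F : ℝ) ^ 2
          + (γ a / #F - (#{p ∈ F ×ˢ F | p.1 ∪ p.2 = a} : ℝ) / (#F : ℝ) ^ 2)) := by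
        refine sum_le_sum fun a ha => ?_
        rw [hlaw]
        refine (negMulLog_le_of_pos (by positivity) (div_pos (hγ a ha) hn)).trans (le_of_eq ?_)
        rw [Real.log_div (hγ a ha).ne' hn.ne']
        ring
    _ = Real.log #F - (∑ p ∈ F ×ˢ F, Real.log (γ (p.1 ∪ p.2))) / (#F : ℝ) ^ 2
          + ((∑ a ∈ F, γ a) / #F - 1) := by
        rw [sum_add_distrib, sum_sub_distrib, sum_sub_distrib, ← sum_mul, ← sum_div, ← sum_div,
          ← sum_div, hcard, hlog]
        field_simp
    _ ≤ _ := by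
        have := (div_le_one hn).2 hsum
        linarith

lemma card_notMem_div (hne : F.Nonempty) (y : α) :
    (#{A ∈ F | y ∉ A} : ℝ) / #F = 1 - (setCount F y : ℝ) / #F := by
  have hn : (#F : ℝ) ≠ 0 := by exact_mod_cast hne.card_pos.ne'
  have h : (setCount F y : ℝ) + #{A ∈ F | y ∉ A} = #F := by
    exact_mod_cast card_filter_add_card_filter_not _
  field_simp
  linarith

/-- A union-closed family in which all elements but one have frequency at most `1 / 3` has at most
`113` members. -/
theorem card_le_of_setCount_le (hF : ∀ A ∈ F, ∀ B ∈ F, A ∪ B ∈ F) {x : α}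
    (hx : x ∈ groundSet F) (hcnt : ∀ y, y ≠ x → 3 * setCount F y ≤ #F) : #F ≤ 113 := by
  by_contra! hlt
  have hne : F.Nonempty := card_pos.1 (by omega)
  have hn : (0 : ℝ) < #F := by exact_mod_cast hne.card_pos
  have hins : insert x ((groundSet F).erase x) = groundSet F := insert_erase hx
  have hlogn : 4.7358 < Real.log #F :=
    lt_log_114.trans_le (Real.log_le_log (by norm_num) (by exact_mod_cast hlt))
  set q : ℝ := (#{A ∈ F | x ∉ A} : ℝ) / #F with hq
  have hq₀ : 0 ≤ q := by positivity
  have hq₁ : q ≤ 1 := div_le_one_of_le₀ (by exact_mod_cast card_filter_le _ _) hn.le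
  have hmain : ∀ r : ℝ, (∀ i ∈ (groundSet F).erase x, r ≤ 1 - (setCount F i : ℝ) / #F) →
      8 / 5 * q * Real.binEntropy q + 8 / 5 * r * (Real.log #F - Real.binEntropy q)
        ≤ traceEntropy (F ×ˢ F) (fun p => p.1 ∪ p.2) (groundSet F) := by
    intro r hr
    have h := traceEntropy_union_ge hne x ((groundSet F).erase x) (notMem_erase _ _)
      (r := r) fun i hi => by rw [card_notMem_div hne]; exact hr i hi
    rwa [hins, traceEntropy_groundSet hne, traceEntropy_singleton hne] at h
  -- With `r = 2 / 3` alone the surplus factor `1 / 15` is too small for `113`. Below `8 / 25` one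
  -- may take `r = 17 / 25`, giving `8 / 5 * r = 136 / 125`; above it, Gibbs' inequality supplies
  -- the missing amount.
  by_cases hall : ∀ y ∈ (groundSet F).erase x, (setCount F y : ℝ) / #F ≤ 8 / 25
  · have h1 := hmain (17 / 25) fun i hi => by linarith [hall i hi]
    have h2 := traceEntropy_union_groundSet_le hF hne (fun _ => 1) (by simp) (by simp)
    have h3 := affine_mul_binEntropy_le (c := 136 / 125) (K := 0.39) (by norm_num) hq₀ hq₁
      fun s => by nlinarith [sq_nonneg (s - 0.21)]
    simp only [Real.log_one, sum_const_zero, zero_div, sub_zero] at h2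
    nlinarith
  · push Not at hall
    obtain ⟨y, hy, hpy⟩ := hall
    have hthird : ∀ i ∈ (groundSet F).erase x, (setCount F i : ℝ) / #F ≤ 1 / 3 := by
      intro i hi
      have : (3 * setCount F i : ℝ) ≤ #F := by exact_mod_cast hcnt i (ne_of_mem_erase hi)
      rw [div_le_div_iff₀ hn (by norm_num)]
      linarith
    have h1 := hmain (2 / 3) fun i hi => by linarith [hthird i hi]
    set p : ℝ := (setCount F y : ℝ) / #F with hp
    have hp3 : p ≤ 1 / 3 := hthird y hy
    have hpn : (setCount F y : ℝ) = p * #F := by rw [hp]; field_simp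
    have hnot : (#{A ∈ F | y ∉ A} : ℝ) = (1 - p) * #F := by
      have := card_notMem_div hne y
      rw [div_eq_iff hn.ne'] at this
      exact this
    -- At `p = 1 / 3` the union contains `y` with probability `5 / 9`; the weights are the ratios
    -- `(5 / 9) / (1 / 3)` and `(4 / 9) / (2 / 3)`. Their total is `(2 / 3 + p) * #F`.
    have h2 := traceEntropy_union_groundSet_le hF hne (fun A => if y ∈ A then 5 / 3 else 2 / 3)
      (fun A _ => by split_ifs <;> norm_num) (by
        rw [sum_ite, sum_const, sum_const, nsmul_eq_mul, nsmul_eq_mul, hnot]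
        change (setCount F y : ℝ) * _ + _ ≤ _
        rw [hpn]
        nlinarith)
    have hlog : ∑ P ∈ F ×ˢ F, Real.log (if y ∈ P.1 ∪ P.2 then 5 / 3 else 2 / 3)
        = ((1 - (1 - p) ^ 2) * Real.log (5 / 3) - (1 - p) ^ 2 * Real.log (3 / 2))
          * (#F : ℝ) ^ 2 := by
      have e : ∀ P ∈ F ×ˢ F, Real.log (if y ∈ P.1 ∪ P.2 then 5 / 3 else 2 / 3)
          = Real.log (5 / 3) - (if y ∉ P.1 ∧ y ∉ P.2 then 1 else 0)
            * (Real.log (5 / 3) + Real.log (3 / 2)) := by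
        intro P _
        have : Real.log (2 / 3) = -Real.log (3 / 2) := by rw [← Real.log_inv]; norm_num
        by_cases h1 : y ∈ P.1 <;> by_cases h2 : y ∈ P.2 <;> simp [h1, h2, this]
      rw [sum_congr rfl e, sum_sub_distrib, ← sum_mul, sum_boole,
        filter_product (fun A => y ∉ A) (fun A => y ∉ A),
        sum_const, card_product, card_product, nsmul_eq_mul]
      push_cast
      rw [hnot]
      ring
    rw [hlog, mul_div_cancel_right₀ _ (pow_pos hn 2).ne'] at h2
    -- The quadratic in `s` is largest close to `0.2`.
    have h3 := affine_mul_binEntropy_le (c := 16 / 15) (K := 0.38) (by norm_num) hq₀ hq₁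
      fun s => by nlinarith [sq_nonneg (s - 0.2)]
    have h4 := lt_log_five_thirds
    have h5 := log_three_halves_lt
    have hD : 0.0865 ≤ (1 - (1 - p) ^ 2) * Real.log (5 / 3) - (1 - p) ^ 2 * Real.log (3 / 2) := by
      -- `0.4624` is the square of `17 / 25`.
      have hw : (1 - p) ^ 2 ≤ 0.4624 := by nlinarith
      have hw0 : 0 ≤ (1 - p) ^ 2 := sq_nonneg _
      nlinarith
    nlinarith

end Family

/-! ### Traces on a minimal 2-good set and incidence counts. -/

section Cross

variable {α ι : Type*} [DecidableEq α] [Fintype ι]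

/-- The set of indices `i` with `e i ∈ A`. -/
def indexTrace (e : ι → α) (A : Finset α) : Finset ι := {i | e i ∈ A}

@[simp] lemma mem_indexTrace {e : ι → α} {A : Finset α} {i : ι} : i ∈ indexTrace e A ↔ e i ∈ A := by
  simp [indexTrace]

variable [DecidableEq ι]

/-- The number of members of `F` with a given trace. -/
def traceCount (F : Finset (Finset α)) (e : ι → α) (T : Finset ι) : ℕ :=
  #{A ∈ F | indexTrace e A = T}

/-- The indices `j` such that every member of `F` with trace `{j}` contains `w`. -/
def forcedIndices (F : Finset (Finset α)) (e : ι → α) (w : α) : Finset ι :=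
  {j | ∀ A ∈ F, indexTrace e A = {j} → w ∈ A}

/-- `F` is union-closed, all elements but `x` have frequency at most `1 / 3`, and the values of `e`
form a minimal 2-good set with respect to `x`. -/
structure IsCross (F : Finset (Finset α)) (x : α) (e : ι → α) : Prop where
  union_mem : ∀ A ∈ F, ∀ B ∈ F, A ∪ B ∈ F
  count_le : ∀ y, y ≠ x → 3 * setCount F y ≤ #F
  ne_apex : ∀ i, e i ≠ x
  meets : ∀ A ∈ F, A ≠ ∅ → A ≠ {x} → (indexTrace e A).Nonempty
  priv : ∀ i, ∃ A ∈ F, indexTrace e A = {i}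

/-- Some members of `F` with trace `{i}` contain `w` and some do not. -/
def Varies (F : Finset (Finset α)) (e : ι → α) (w : α) (i : ι) : Prop :=
  (∃ A ∈ F, indexTrace e A = {i} ∧ w ∈ A) ∧ ∃ A ∈ F, indexTrace e A = {i} ∧ w ∉ A

variable {F : Finset (Finset α)} {x w : α} {e : ι → α} {i j : ι} {T : Finset ι}

lemma indexTrace_union (A B : Finset α) :
    indexTrace e (A ∪ B) = indexTrace e A ∪ indexTrace e B := by
  ext; simp

lemma mem_forcedIndices : j ∈ forcedIndices F e w ↔ ∀ A ∈ F, indexTrace e A = {j} → w ∈ A := by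
  simp [forcedIndices]

lemma notMem_forcedIndices :
    j ∉ forcedIndices F e w ↔ ∃ A ∈ F, indexTrace e A = {j} ∧ w ∉ A := by
  simp [forcedIndices]

lemma Varies.notMem (h : Varies F e w i) : i ∉ forcedIndices F e w :=
  notMem_forcedIndices.2 h.2

lemma sum_traceCount (F : Finset (Finset α)) (e : ι → α) : ∑ T, traceCount F e T = #F :=
  (card_eq_sum_card_fiberwise (fun _ _ => mem_coe.2 (mem_univ _))).symm

lemma sum_card_indexTrace_inter (F : Finset (Finset α)) (e : ι → α) (J : Finset ι) :
    ∑ A ∈ F, #(indexTrace e A ∩ J) = ∑ j ∈ J, setCount F (e j) := by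
  simp only [setCount, card_filter]
  rw [sum_comm]
  refine sum_congr rfl fun A _ => ?_
  rw [← card_filter, inter_comm, ← filter_mem_eq_inter]
  simp

lemma sum_card_inter_mul_traceCount (F : Finset (Finset α)) (e : ι → α) (J : Finset ι) :
    ∑ T, #(T ∩ J) * traceCount F e T = ∑ j ∈ J, setCount F (e j) := by
  rw [← sum_card_indexTrace_inter, ← sum_fiberwise F (indexTrace e)]
  refine sum_congr rfl fun T _ => ?_
  rw [sum_congr rfl fun A hA => by rw [(mem_filter.1 hA).2], sum_const, smul_eq_mul, mul_comm,
    traceCount]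

lemma two_le_traceCount {A B : Finset α} (hA : A ∈ F) (hB : B ∈ F) (hAT : indexTrace e A = T)
    (hBT : indexTrace e B = T) (hne : A ≠ B) : 2 ≤ traceCount F e T :=
  one_lt_card.2 ⟨A, mem_filter.2 ⟨hA, hAT⟩, B, mem_filter.2 ⟨hB, hBT⟩, hne⟩

namespace IsCross

/-- Unions of members with singleton traces realise every nonempty trace, and any union-stable
property survives. -/
lemma exists_indexTrace_eq (h : IsCross F x e) (P : Finset α → Prop)
    (hP : ∀ A B, P A → P B → P (A ∪ B)) (hT : T.Nonempty)
    (hPT : ∀ i ∈ T, ∃ A ∈ F, indexTrace e A = {i} ∧ P A) :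
    ∃ A ∈ F, indexTrace e A = T ∧ P A := by
  induction hT using Finset.Nonempty.cons_induction with
  | singleton i => exact hPT i (mem_singleton_self i)
  | cons i T hi hT ih =>
    obtain ⟨A, hA, hAT, hPA⟩ := hPT i (mem_cons_self _ _)
    obtain ⟨B, hB, hBT, hPB⟩ := ih fun j hj => hPT j (mem_cons.2 (Or.inr hj))
    exact ⟨A ∪ B, h.union_mem A hA B hB, by rw [indexTrace_union, hAT, hBT, cons_eq_insert]; rfl,
      hP A B hPA hPB⟩

lemma exists_mem (h : IsCross F x e) (hT : T.Nonempty) : ∃ A ∈ F, indexTrace e A = T := by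
  obtain ⟨A, hA, hAT, -⟩ := h.exists_indexTrace_eq (fun _ => True) (fun _ _ _ _ => trivial) hT
    fun i _ => by obtain ⟨A, hA, hAi⟩ := h.priv i; exact ⟨A, hA, hAi, trivial⟩
  exact ⟨A, hA, hAT⟩

lemma exists_mem_of_subset (h : IsCross F x e) (hT : T.Nonempty) {A : Finset α} (hA : A ∈ F)
    (hAT : indexTrace e A ⊆ T) (hw : w ∈ A) : ∃ B ∈ F, indexTrace e B = T ∧ w ∈ B := by
  obtain ⟨B, hB, hBT⟩ := h.exists_mem hT
  exact ⟨A ∪ B, h.union_mem A hA B hB, by rw [indexTrace_union, hBT, union_eq_right.2 hAT],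
    mem_union_left _ hw⟩

lemma exists_notMem (h : IsCross F x e) (hT : T.Nonempty)
    (hd : Disjoint T (forcedIndices F e w)) : ∃ A ∈ F, indexTrace e A = T ∧ w ∉ A :=
  h.exists_indexTrace_eq (fun A => w ∉ A) (fun A B hA hB => by simp [hA, hB]) hT
    fun _ hi => notMem_forcedIndices.1 (disjoint_left.1 hd hi)

lemma exists_mem_of_forced (h : IsCross F x e) (hj : j ∈ forcedIndices F e w) (hjT : j ∈ T) :
    ∃ A ∈ F, indexTrace e A = T ∧ w ∈ A := by
  obtain ⟨A, hA, hAj⟩ := h.priv j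
  exact h.exists_mem_of_subset ⟨j, hjT⟩ hA (by simpa [hAj] using hjT)
    (mem_forcedIndices.1 hj A hA hAj)

lemma exists_mem_of_varies (h : IsCross F x e) (hv : Varies F e w i) (hiT : i ∈ T) :
    ∃ A ∈ F, indexTrace e A = T ∧ w ∈ A := by
  obtain ⟨A, hA, hAi, hw⟩ := hv.1
  exact h.exists_mem_of_subset ⟨i, hiT⟩ hA (by simpa [hAi] using hiT) hw

lemma one_le_traceCount (h : IsCross F x e) (hT : T.Nonempty) : 1 ≤ traceCount F e T := by
  obtain ⟨A, hA, hAT⟩ := h.exists_mem hT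
  exact card_pos.2 ⟨A, mem_filter.2 ⟨hA, hAT⟩⟩

/-- A varying `w` can be added to a trace containing `i`, and avoided altogether when no index of
the trace forces it. -/
lemma two_le_traceCount_of_disjoint (h : IsCross F x e) (hv : Varies F e w i) (hiT : i ∈ T)
    (hd : Disjoint T (forcedIndices F e w)) : 2 ≤ traceCount F e T := by
  obtain ⟨A, hA, hAT, hwA⟩ := h.exists_mem_of_varies hv hiT
  obtain ⟨B, hB, hBT, hwB⟩ := h.exists_notMem ⟨i, hiT⟩ hd
  exact two_le_traceCount hA hB hAT hBT fun hAB => hwB (hAB ▸ hwA)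

lemma traceCount_empty_le (h : IsCross F x e) : traceCount F e ∅ ≤ 2 := by
  refine (card_le_card (t := {∅, {x}}) fun A hA => ?_).trans card_le_two
  obtain ⟨hA, hAT⟩ := mem_filter.1 hA
  by_contra hne
  simp only [mem_insert, mem_singleton, not_or] at hne
  exact (h.meets A hA hne.1 hne.2).ne_empty hAT

/-- The double count of incidences between `F` and the values of `e` on `J`. -/
lemma weight_le (h : IsCross F x e) (J : Finset ι) (k : ℕ) (m : Finset ι → ℕ)
    (hm : ∀ T : Finset ι, T.Nonempty → m T ≤ traceCount F e T) :
    3 * ∑ T, (#(T ∩ J) - k) * m T + 3 * k * #F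
      ≤ #J * #F + 3 * ∑ T, (k - #(T ∩ J)) * traceCount F e T := by
  have h1 : 3 * ∑ T, #(T ∩ J) * traceCount F e T ≤ #J * #F := by
    rw [sum_card_inter_mul_traceCount, mul_sum, ← smul_eq_mul, ← sum_const]
    exact sum_le_sum fun j _ => h.count_le _ (h.ne_apex j)
  -- Subtraction is truncated: it keeps the excess over `k`, and the deficit is the separate sum on
  -- the right. At the empty trace the excess vanishes, so no bound on `m` is needed there.
  have h2 : ∑ T, (#(T ∩ J) - k) * m T ≤ ∑ T, (#(T ∩ J) - k) * traceCount F e T := by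
    refine sum_le_sum fun T _ => ?_
    rcases T.eq_empty_or_nonempty with rfl | hT
    · simp
    · exact Nat.mul_le_mul_left _ (hm T hT)
  have h3 : ∑ T, (#(T ∩ J) - k) * traceCount F e T + k * #F
      = ∑ T, #(T ∩ J) * traceCount F e T + ∑ T, (k - #(T ∩ J)) * traceCount F e T := by
    rw [← sum_traceCount F e, mul_sum, ← sum_add_distrib, ← sum_add_distrib]
    refine sum_congr rfl fun T _ => ?_
    rw [← add_mul, ← add_mul]
    congr 1
    omega
  nlinarith

lemma weight_univ_le (h : IsCross F x e) (m : Finset ι → ℕ)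
    (hm : ∀ T : Finset ι, T.Nonempty → m T ≤ traceCount F e T) :
    3 * ∑ T, (#T - 1) * m T + 3 * #F ≤ Fintype.card ι * #F + 6 := by
  have h1 := h.weight_le univ 1 m hm
  have h2 : ∑ T, (1 - #T) * traceCount F e T = traceCount F e ∅ := by
    rw [sum_eq_single ∅]
    · simp
    · intro T _ hT
      rw [Nat.sub_eq_zero_of_le (card_pos.2 (nonempty_iff_ne_empty.2 hT)), zero_mul]
    · simp
  simp only [inter_univ, card_univ] at h1
  rw [h2] at h1
  have := h.traceCount_empty_le
  linarith

/-- At most two sets agree off `x`, so among three members some pair differs at an element other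
than `x`. -/
lemma exists_varies (h : 3 ≤ traceCount F e {i}) (x : α) : ∃ w, w ≠ x ∧ Varies F e w i := by
  obtain ⟨A, hA⟩ := card_pos.1 (show 0 < traceCount F e {i} by omega)
  obtain ⟨B, hB, hAB⟩ : ∃ B ∈ F.filter (indexTrace e · = {i}), B.erase x ≠ A.erase x := by
    by_contra! hall
    have : F.filter (indexTrace e · = {i}) ⊆ {A.erase x, insert x (A.erase x)} := by
      intro B hB
      rw [mem_insert, mem_singleton, ← hall B hB]
      by_cases hx : x ∈ B
      · exact Or.inr (insert_erase hx).symm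
      · exact Or.inl (erase_eq_of_notMem hx).symm
    have := (card_le_card this).trans card_le_two
    unfold traceCount at h
    omega
  obtain ⟨w, hw⟩ : ∃ w, ¬(w ∈ B.erase x ↔ w ∈ A.erase x) := by
    by_contra! hall
    exact hAB (Finset.ext hall)
  obtain ⟨hAF, hAi⟩ := mem_filter.1 hA
  obtain ⟨hBF, hBi⟩ := mem_filter.1 hB
  simp only [mem_erase] at hw
  have hwx : w ≠ x := fun hwx => hw (by simp [hwx])
  refine ⟨w, hwx, ?_⟩
  by_cases hwA : w ∈ A <;> by_cases hwB : w ∈ B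
  · exact absurd (by simp [hwA, hwB]) hw
  · exact ⟨⟨A, hAF, hAi, hwA⟩, B, hBF, hBi, hwB⟩
  · exact ⟨⟨B, hBF, hBi, hwB⟩, A, hAF, hAi, hwA⟩
  · exact absurd (by simp [hwA, hwB]) hw

/-- The number of members of `F` with trace `{u, v}` that avoid `w` is large if `w` is forced at
both `u` and `v`: double count incidences with `w` and the values of `e` off `{u, v}`. -/
lemma weight_forced_pair_le (h : IsCross F x e) (hwx : w ≠ x) (hv : Varies F e w i) {u v : ι}
    (hu : u ∈ forcedIndices F e w) (hv' : v ∈ forcedIndices F e w) :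
    3 * ∑ T : Finset ι, (#(T ∩ (univ \ {u, v})) + (if u ∈ T ∨ v ∈ T ∨ i ∈ T then 1 else 0) - 1)
        + 3 * #F
      ≤ (#(univ \ {u, v}) + 1) * #F + 6 + 3 * #{A ∈ F | indexTrace e A = {u, v} ∧ w ∉ A} := by
  set J : Finset ι := univ \ {u, v} with hJ
  let f : Finset α → ℕ := fun A => #(indexTrace e A ∩ J) + if w ∈ A then 1 else 0
  have h1 : 3 * ∑ A ∈ F, f A ≤ (#J + 1) * #F := by
    have h2 : ∑ A ∈ F, f A = ∑ j ∈ J, setCount F (e j) + setCount F w := by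
      rw [sum_add_distrib, sum_card_indexTrace_inter, ← card_filter, setCount]
    have h3 : ∑ j ∈ J, 3 * setCount F (e j) ≤ #J * #F := by
      rw [← smul_eq_mul, ← sum_const]
      exact sum_le_sum fun j _ => h.count_le _ (h.ne_apex j)
    have := h.count_le w hwx
    rw [h2]
    rw [← mul_sum] at h3
    linarith
  have h2 : ∑ T : Finset ι, (#(T ∩ J) + (if u ∈ T ∨ v ∈ T ∨ i ∈ T then 1 else 0) - 1)
      ≤ ∑ A ∈ F, (f A - 1) := by
    rw [← sum_fiberwise F (indexTrace e)]
    refine sum_le_sum fun T _ => ?_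
    rcases T.eq_empty_or_nonempty with rfl | hT
    · simp
    -- One member per trace suffices for the lower bound; it is chosen to contain `w` whenever the
    -- trace guarantees one that does.
    have key : ∃ A ∈ F, indexTrace e A = T ∧ ((u ∈ T ∨ v ∈ T ∨ i ∈ T) → w ∈ A) := by
      by_cases hc : u ∈ T ∨ v ∈ T ∨ i ∈ T
      · obtain ⟨A, hA, hAT, hw⟩ : ∃ A ∈ F, indexTrace e A = T ∧ w ∈ A := by
          rcases hc with hc | hc | hc
          · exact h.exists_mem_of_forced hu hc
          · exact h.exists_mem_of_forced hv' hc
          · exact h.exists_mem_of_varies hv hc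
        exact ⟨A, hA, hAT, fun _ => hw⟩
      · obtain ⟨A, hA, hAT⟩ := h.exists_mem hT
        exact ⟨A, hA, hAT, fun hc' => absurd hc' hc⟩
    obtain ⟨A, hA, hAT, hw⟩ := key
    refine le_trans ?_ (single_le_sum (f := fun A => f A - 1) (fun _ _ => Nat.zero_le _)
      (mem_filter.2 ⟨hA, hAT⟩))
    simp only [f, hAT]
    refine Nat.sub_le_sub_right (Nat.add_le_add_left ?_ _) 1
    split_ifs with h3 h4
    · exact le_rfl
    · exact absurd (hw h3) h4
    · exact Nat.zero_le _
    · exact le_rfl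
  have h3 : ∑ A ∈ F, (f A - 1) + #F = ∑ A ∈ F, f A + ∑ A ∈ F, (1 - f A) := by
    rw [card_eq_sum_ones, ← sum_add_distrib, ← sum_add_distrib]
    exact sum_congr rfl fun A _ => by omega
  -- A deficit needs `f A = 0`: the trace lies in `{u, v}` and `w ∉ A`. Forcing at `u` and `v`
  -- excludes the two singleton traces.
  have h4 : ∑ A ∈ F, (1 - f A) ≤ 2 + #{A ∈ F | indexTrace e A = {u, v} ∧ w ∉ A} := by
    calc ∑ A ∈ F, (1 - f A) ≤ ∑ A ∈ F, ((if indexTrace e A = ∅ then 1 else 0)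
          + if indexTrace e A = {u, v} ∧ w ∉ A then 1 else 0) := by
          refine sum_le_sum fun A hA => ?_
          by_cases hfA : f A = 0
          · simp only [f, Nat.add_eq_zero_iff, card_eq_zero, ite_eq_right_iff, one_ne_zero,
              imp_false] at hfA
            obtain ⟨hAJ, hwA⟩ := hfA
            have hsub : indexTrace e A ⊆ {u, v} := by
              intro j hj
              by_contra hj'
              have : j ∈ indexTrace e A ∩ J := mem_inter.2 ⟨hj, by simp [hJ] at hj' ⊢; exact hj'⟩
              simp [hAJ] at this
            have hu' : indexTrace e A ≠ {u} := fun hAu => hwA (mem_forcedIndices.1 hu A hA hAu)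
            have hv'' : indexTrace e A ≠ {v} := fun hAv => hwA (mem_forcedIndices.1 hv' A hA hAv)
            have hcases : indexTrace e A = ∅ ∨ indexTrace e A = {u, v} := by
              refine (indexTrace e A).eq_empty_or_nonempty.imp_right fun hne => ?_
              refine hsub.antisymm (insert_subset ?_ (singleton_subset_iff.2 ?_))
              · by_contra hcu
                refine hv'' (eq_singleton_iff_nonempty_unique_mem.2 ⟨hne, fun j hj => ?_⟩)
                exact (mem_insert.1 (hsub hj)).elim (fun hju => absurd (hju ▸ hj) hcu)
                  mem_singleton.1
              · by_contra hcv
                refine hu' (eq_singleton_iff_nonempty_unique_mem.2 ⟨hne, fun j hj => ?_⟩)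
                exact (mem_insert.1 (hsub hj)).elim id
                  fun hjv => absurd (mem_singleton.1 hjv ▸ hj) hcv
            rcases hcases with hc | hc
            · rw [if_pos hc]
              omega
            · rw [if_pos (show indexTrace e A = {u, v} ∧ w ∉ A from ⟨hc, hwA⟩)]
              omega
          · omega
      _ ≤ _ := by
          rw [sum_add_distrib, ← card_filter, ← card_filter]
          exact Nat.add_le_add_right h.traceCount_empty_le _
  nlinarith

lemma traceCount_forced_pair_ge (h : IsCross F x e) {u v : ι}
    (hu : u ∈ forcedIndices F e w) :
    #{A ∈ F | indexTrace e A = {u, v} ∧ w ∉ A} + 1 ≤ traceCount F e {u, v} := by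
  obtain ⟨A, hA, hAT, hw⟩ := h.exists_mem_of_forced hu (mem_insert_self u {v})
  rw [traceCount, ← filter_filter]
  exact card_lt_card (filter_ssubset.2 ⟨A, mem_filter.2 ⟨hA, hAT⟩, by simpa using hw⟩)

/-- Joining a member of trace `{u, v}` without `w` to one of trace `R` without `w` avoids `w`,
whereas forcing at `u` gives another member with `w`. -/
lemma two_le_traceCount_insert_pair (h : IsCross F x e) {u v : ι} {R : Finset ι}
    (hu : u ∈ forcedIndices F e w)
    (hK : 0 < #{A ∈ F | indexTrace e A = {u, v} ∧ w ∉ A})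
    (hR : Disjoint R (forcedIndices F e w)) : 2 ≤ traceCount F e ({u, v} ∪ R) := by
  obtain ⟨A, hA, hAT, hwA⟩ := h.exists_mem_of_forced hu
    (show u ∈ {u, v} ∪ R from mem_union_left _ (mem_insert_self u {v}))
  obtain ⟨B, hB⟩ := card_pos.1 hK
  obtain ⟨hB, hBT, hwB⟩ := mem_filter.1 hB
  rcases R.eq_empty_or_nonempty with rfl | hne
  · rw [union_empty] at hAT ⊢
    exact two_le_traceCount hA hB hAT hBT fun hAB => hwB (hAB ▸ hwA)
  obtain ⟨C, hC, hCT, hwC⟩ := h.exists_notMem hne hR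
  refine two_le_traceCount hA (h.union_mem B hB C hC) hAT (by rw [indexTrace_union, hBT, hCT])
    fun hAB => ?_
  rw [hAB, mem_union] at hwA
  exact hwA.elim hwB hwC

/-- Exchanging `e u` for an element that is forced exactly at `u`. -/
lemma update (h : IsCross F x e) (hwx : w ≠ x) {u : ι} (hu : forcedIndices F e w = {u}) :
    IsCross F x (Function.update e u w) := by
  have huf : u ∈ forcedIndices F e w := by simp [hu]
  have htr : ∀ A j, j ∈ indexTrace (Function.update e u w) A ↔
      if j = u then w ∈ A else j ∈ indexTrace e A := by
    intro A j
    rw [mem_indexTrace]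
    split_ifs with hj
    · rw [hj, Function.update_self]
    · rw [Function.update_of_ne hj, mem_indexTrace]
  refine ⟨h.union_mem, h.count_le, fun j => ?_, fun A hA h0 hx => ?_, fun j => ?_⟩
  · by_cases hj : j = u
    · rwa [hj, Function.update_self]
    · rw [Function.update_of_ne hj]
      exact h.ne_apex j
  · by_cases hAu : indexTrace e A = {u}
    · exact ⟨u, by rw [htr, if_pos rfl]; exact mem_forcedIndices.1 huf A hA hAu⟩
    · obtain ⟨j, hj, hju⟩ : ∃ j ∈ indexTrace e A, j ≠ u := by
        by_contra! hall
        exact hAu (eq_singleton_iff_nonempty_unique_mem.2 ⟨h.meets A hA h0 hx, hall⟩)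
      exact ⟨j, by rwa [htr, if_neg hju]⟩
  · by_cases hj : j = u
    · obtain ⟨A, hA, hAu⟩ := h.priv u
      refine ⟨A, hA, ?_⟩
      ext l
      rw [htr, hj, hAu, mem_singleton]
      split_ifs with hl
      · simpa [hl] using mem_forcedIndices.1 huf A hA hAu
      · rfl
    · obtain ⟨A, hA, hAj, hw⟩ := notMem_forcedIndices.1
        (show j ∉ forcedIndices F e w by simpa [hu] using hj)
      refine ⟨A, hA, ?_⟩
      ext l
      rw [htr, hAj, mem_singleton]
      split_ifs with hl
      · simp only [hw, false_iff]
        rintro rfl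
        exact hj hl
      · rfl

/-- Members containing `w` whose old traces are `T` and `T.erase u` acquire the same new trace `T`.
-/
lemma two_le_traceCount_update (h : IsCross F x e) (hv : Varies F e w i) {u : ι} (hui : u ≠ i)
    (huf : u ∈ forcedIndices F e w) (huT : u ∈ T) (hiT : i ∈ T) :
    2 ≤ traceCount F (Function.update e u w) T := by
  obtain ⟨A, hA, hAT, hwA⟩ := h.exists_mem_of_forced huf huT
  obtain ⟨B, hB, hBT, hwB⟩ :=
    h.exists_mem_of_varies hv (mem_erase.2 ⟨hui.symm, hiT⟩ : i ∈ T.erase u)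
  have htr : ∀ A, w ∈ A → (indexTrace e A).erase u = T.erase u →
      indexTrace (Function.update e u w) A = T := by
    intro A hw hAT
    ext l
    rw [mem_indexTrace]
    by_cases hl : l = u
    · simp [hl, hw, huT]
    · rw [Function.update_of_ne hl, ← mem_indexTrace (e := e)]
      have := Finset.ext_iff.1 hAT l
      simpa [hl] using this
  refine two_le_traceCount hA hB (htr A hwA (by rw [hAT])) (htr B hwB (by rw [hBT, erase_idem]))
    fun hAB => ?_
  have h1 : u ∈ indexTrace e A := by rw [hAT]; exact huT
  rw [hAB, hBT] at h1
  exact notMem_erase u T h1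

end IsCross

end Cross

/-! ### Finite weight computations. -/

section FiniteSums

/-- The finite set of indices at which the binary expansion of `t` has a `1`. -/
def maskSet (t : ℕ) : Finset (Fin 5) := {j | t.testBit j}

lemma sum_maskSet (f : Finset (Fin 5) → ℕ) : ∑ T, f T = ∑ t ∈ range 32, f (maskSet t) := by
  have hinj : Set.InjOn maskSet (range 32) := by
    have : ∀ s < 32, ∀ t < 32, maskSet s = maskSet t → s = t := by decide +kernel
    intro s hs t ht
    exact this s (by simpa using hs) t (by simpa using ht)
  have huniv : (univ : Finset (Finset (Fin 5))) = (range 32).image maskSet := by decide +kernel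
  rw [huniv, sum_image hinj]

-- Subsets of five points are bitmasks here, so that the check over all self-maps without fixed
-- points is plain arithmetic. The Boolean test says that the subset is closed under the map.
set_option maxRecDepth 100000 in
lemma sum_mask_ge : ∀ a b c d f : Fin 5, a ≠ 0 → b ≠ 1 → c ≠ 2 → d ≠ 3 → f ≠ 4 →
    78 ≤ ∑ t ∈ range 32, (t % 2 + t / 2 % 2 + t / 4 % 2 + t / 8 % 2 + t / 16 % 2 - 1) *
      bif (!t.testBit 0 || t.testBit a) && (!t.testBit 1 || t.testBit b) &&
        (!t.testBit 2 || t.testBit c) && (!t.testBit 3 || t.testBit d) &&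
        (!t.testBit 4 || t.testBit f) then 1 else 2 := by
  decide +kernel

/-- For a fixed-point-free self-map of five points, the total weight of the subsets is at least
`78` when those that are not closed under the map are counted twice. -/
lemma sum_not_closed_five (g : Fin 5 → Fin 5) (hg : ∀ j, g j ≠ j) :
    78 ≤ ∑ T : Finset (Fin 5), (#T - 1) * if ∃ j ∈ T, g j ∉ T then 2 else 1 := by
  rw [sum_maskSet]
  refine (sum_mask_ge (g 0) (g 1) (g 2) (g 3) (g 4) (hg 0) (hg 1) (hg 2) (hg 3) (hg 4)).trans_eq
    (sum_congr rfl fun t ht => ?_)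
  have hcard : ∀ t < 32, t % 2 + t / 2 % 2 + t / 4 % 2 + t / 8 % 2 + t / 16 % 2
      = #(maskSet t) := by decide +kernel
  rw [hcard t (mem_range.1 ht)]
  congr 1
  have hiff : (∃ j ∈ maskSet t, g j ∉ maskSet t) ↔
      ¬ ((!t.testBit 0 || t.testBit (g 0)) && (!t.testBit 1 || t.testBit (g 1)) &&
        (!t.testBit 2 || t.testBit (g 2)) && (!t.testBit 3 || t.testBit (g 3)) &&
        (!t.testBit 4 || t.testBit (g 4))) = true := by
    simp only [maskSet, mem_filter, mem_univ, true_and, Fin.exists_fin_succ, IsEmpty.exists_iff]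
    simp
    grind
  rw [cond_eq_ite, if_congr hiff rfl rfl, ite_not]

-- The two doubling conditions come from exchanging a point for `w` and from the map of the new
-- configuration. Together they reach `29`, and `3 * 29 - 6 = 81`.
set_option maxRecDepth 100000 in
lemma sum_exchange_four : ∀ g₀ g₁ g₂ g₃ u : Fin 4, g₀ ≠ 0 → g₁ ≠ 1 → g₂ ≠ 2 → g₃ ≠ 3 → u ≠ 0 →
    29 ≤ ∑ T : Finset (Fin 4), (#T - 1) *
      if (u ∈ T ∧ 0 ∈ T) ∨ ∃ j ∈ T, ![g₀, g₁, g₂, g₃] j ∉ T then 2 else 1 := by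
  decide +kernel

lemma sum_forced_pair_four : ∀ i u v : Fin 4, i ≠ u → i ≠ v → u ≠ v →
    (∑ T : Finset (Fin 4),
      (#(T ∩ (univ \ {u, v})) + (if u ∈ T ∨ v ∈ T ∨ i ∈ T then 1 else 0) - 1) = 15 ∧
    #(univ \ {u, v}) = 2) ∧
    ∑ T : Finset (Fin 4), (#T - 1) * (if T = {u, v} then 14 else 1) = 30 := by
  decide +kernel

lemma sum_forced_pair_five : ∀ i u v : Fin 5, i ≠ u → i ≠ v → u ≠ v →
    ∑ T : Finset (Fin 5),
      (#(T ∩ (univ \ {u, v})) + (if u ∈ T ∨ v ∈ T ∨ i ∈ T then 1 else 0) - 1) = 45 ∧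
    #(univ \ {u, v}) = 3 := by
  decide +kernel

set_option maxRecDepth 100000 in
lemma sum_forced_five : ∀ (i : Fin 5) (Q : Finset (Fin 5)), i ∉ Q → 2 ≤ #Q →
    78 ≤ ∑ T : Finset (Fin 5), (#T - 1) *
      if #T = 2 ∧ T ⊆ Q then 7 else if #(T ∩ Q) = 2 then 2
        else if i ∈ T ∧ T ∩ Q = ∅ then 2 else 1 := by
  decide +kernel

lemma sum_erase_five : ∀ z y g : Fin 5, y ≠ z → g ≠ y →
    42 ≤ ∑ T : Finset (Fin 5), (#(T ∩ univ.erase z) - 1) * if y ∈ T ∧ g ∉ T then 2 else 1 := by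
  decide +kernel

end FiniteSums

/-! ### Size of the family for each size of the 2-good set. -/

namespace IsCross

variable {α : Type*} [DecidableEq α] {F : Finset (Finset α)} {x : α}

/-- Only the traces `∅` and `{z}` miss all indices other than `z`, and each occurs at most twice. -/
lemma sum_erase_traceCount_le {ι : Type*} [Fintype ι] [DecidableEq ι] {e : ι → α}
    (h : IsCross F x e) {z : ι} (hz : traceCount F e {z} ≤ 2) :
    ∑ T : Finset ι, (1 - #(T ∩ univ.erase z)) * traceCount F e T ≤ 4 := by
  have hle : ∀ T : Finset ι, (1 - #(T ∩ univ.erase z)) * traceCount F e T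
      ≤ if T ∈ ({∅, {z}} : Finset (Finset ι)) then 2 else 0 := by
    intro T
    by_cases hT : T ∩ univ.erase z = ∅
    · have hTz : T = ∅ ∨ T = {z} := by
        refine subset_singleton_iff.1 fun j hj => mem_singleton.2 ?_
        by_contra hjz
        have : j ∈ T ∩ univ.erase z := mem_inter.2 ⟨hj, mem_erase.2 ⟨hjz, mem_univ j⟩⟩
        simp [hT] at this
      rw [hT, card_empty, Nat.sub_zero, one_mul, if_pos (by simpa using hTz)]
      rcases hTz with rfl | rfl
      · exact h.traceCount_empty_le
      · exact hz
    · rw [Nat.sub_eq_zero_of_le (card_pos.2 (nonempty_iff_ne_empty.2 hT)), zero_mul]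
      exact Nat.zero_le _
  calc _ ≤ ∑ T : Finset ι, if T ∈ ({∅, {z}} : Finset (Finset ι)) then 2 else 0 :=
        sum_le_sum fun T _ => hle T
    _ = #({∅, {z}} : Finset (Finset ι)) * 2 := by
        rw [← sum_filter, filter_mem_eq_inter, univ_inter, sum_const, smul_eq_mul]
    _ ≤ 4 := by have := card_le_two (a := (∅ : Finset ι)) (b := {z}); omega

/-- Otherwise the count over the other three indices reads `30 + 3n ≤ 3n + 12`. -/
lemma three_le_traceCount_four {e : Fin 4 → α} (h : IsCross F x e) (z : Fin 4) :
    3 ≤ traceCount F e {z} := by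
  by_contra! hz
  have h1 := h.weight_le (univ.erase z) 1 (fun _ => 1) fun T hT => h.one_le_traceCount hT
  have h2 := h.sum_erase_traceCount_le (z := z) (by omega)
  have h3 : ∀ z : Fin 4, ∑ T : Finset (Fin 4), (#(T ∩ univ.erase z) - 1) * 1 = 10 ∧
    #((univ : Finset (Fin 4)).erase z) = 3 := by decide +kernel
  rw [(h3 z).1, (h3 z).2] at h1
  omega

/-- Two forced indices `u`, `v` would give at least `13` members of trace `{u, v}` without `w`,
hence multiplicity at least `14`, total weight `30` and `n ≥ 84`. -/
lemma forced_subset_singleton_four {e : Fin 4 → α} (h : IsCross F x e) (hn : #F ≤ 80) {w : α}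
    (hwx : w ≠ x) {i : Fin 4} (hv : Varies F e w i) : #(forcedIndices F e w) ≤ 1 := by
  by_contra! hQ
  obtain ⟨u, hu, v, hv', huv⟩ := one_lt_card.1 hQ
  have hiu : i ≠ u := fun hiu => hv.notMem (hiu ▸ hu)
  have hiv : i ≠ v := fun hiv => hv.notMem (hiv ▸ hv')
  obtain ⟨⟨h1, h2⟩, h3⟩ := sum_forced_pair_four i u v hiu hiv huv
  have h4 := h.weight_forced_pair_le hwx hv hu hv'
  rw [h1, h2] at h4
  have h5 := h.traceCount_forced_pair_ge (v := v) hu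
  have h6 := h.weight_univ_le (fun T => if T = {u, v} then 14 else 1) fun T hT => by
    split_ifs with hc
    · rw [hc]; omega
    · exact h.one_le_traceCount hT
  rw [h3, Fintype.card_fin] at h6
  omega

/-- If every singleton trace occurs at least three times and elements are forced at most once,
the occurrences of varying elements define a fixed-point-free map on the indices. -/
lemma exists_map {s : ℕ} [Nontrivial (Fin s)] {e : Fin s → α}
    (h3 : ∀ j, 3 ≤ traceCount F e {j})
    (hQ : ∀ (w : α) (j : Fin s), w ≠ x → Varies F e w j → #(forcedIndices F e w) ≤ 1)
    (h : IsCross F x e) :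
    ∃ g : Fin s → Fin s, (∀ j, g j ≠ j) ∧
      ∀ (j : Fin s) (T : Finset (Fin s)), j ∈ T → g j ∉ T → 2 ≤ traceCount F e T := by
  have key : ∀ j, ∃ k, k ≠ j ∧ ∀ T : Finset (Fin s), j ∈ T → k ∉ T → 2 ≤ traceCount F e T := by
    intro j
    obtain ⟨w, hwx, hv⟩ := exists_varies (h3 j) x
    obtain ⟨k, hkj, hk⟩ : ∃ k, k ≠ j ∧ forcedIndices F e w ⊆ {k} := by
      obtain ⟨k, hk⟩ := card_le_one_iff_subset_singleton.1 (hQ w j hwx hv)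
      by_cases hkj : k = j
      · obtain ⟨k', hk'⟩ := exists_ne j
        refine ⟨k', hk', fun l hl => ?_⟩
        have := mem_singleton.1 (hk hl)
        exact absurd (this.trans hkj ▸ hl) hv.notMem
      · exact ⟨k, hkj, hk⟩
    refine ⟨k, hkj, fun T hjT hkT => h.two_le_traceCount_of_disjoint hv hjT ?_⟩
    exact disjoint_left.2 fun l hl hlQ => hkT (mem_singleton.1 (hk hlQ) ▸ hl)
  choose g hg hgT using key
  exact ⟨g, hg, hgT⟩

theorem card_ge_of_four {e : Fin 4 → α} (h : IsCross F x e) : 81 ≤ #F := by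
  by_contra! hn
  have hn : #F ≤ 80 := by omega
  obtain ⟨w, hwx, hv⟩ := exists_varies (h.three_le_traceCount_four 0) x
  rcases (forcedIndices F e w).eq_empty_or_nonempty with hQ | ⟨u, hu⟩
  · have h1 := h.weight_univ_le (fun T => if 0 ∈ T then 2 else 1) fun T hT => by
      split_ifs with hc
      · exact h.two_le_traceCount_of_disjoint hv hc (by simp [hQ])
      · exact h.one_le_traceCount hT
    have h2 : ∑ T : Finset (Fin 4), (#T - 1) * (if 0 ∈ T then 2 else 1) = 29 := by decide +kernel
    rw [h2, Fintype.card_fin] at h1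
    omega
  · have hQ : forcedIndices F e w = {u} :=
      (card_eq_one.1 (le_antisymm (h.forced_subset_singleton_four hn hwx hv)
        (card_pos.2 ⟨u, hu⟩))).elim fun a ha => by
          rw [ha] at hu ⊢
          rw [mem_singleton.1 hu]
    have hu0 : u ≠ 0 := fun hu0 => hv.notMem (hu0 ▸ hu)
    -- After the exchange, traces containing both `u` and `0` are doubled, in addition to the
    -- doublings that the new configuration provides by itself.
    have h' := h.update hwx hQ
    obtain ⟨g, hg, hgT⟩ := h'.exists_map h'.three_le_traceCount_four
      fun w' j hw' hv' => h'.forced_subset_singleton_four hn hw' hv'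
    have h1 := h'.weight_univ_le
      (fun T => if (u ∈ T ∧ 0 ∈ T) ∨ ∃ j ∈ T, ![g 0, g 1, g 2, g 3] j ∉ T then 2 else 1)
      fun T hT => by
        split_ifs with hc
        · rcases hc with ⟨huT, h0T⟩ | ⟨j, hj, hjT⟩
          · exact h.two_le_traceCount_update hv hu0 hu huT h0T
          · refine hgT j T hj ?_
            convert hjT using 2
            fin_cases j <;> rfl
        · exact h'.one_le_traceCount hT
    have h2 := sum_exchange_four (g 0) (g 1) (g 2) (g 3) u (hg 0) (hg 1) (hg 2) (hg 3) hu0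
    rw [Fintype.card_fin] at h1
    omega

lemma forced_subset_singleton_five {e : Fin 5 → α} (h : IsCross F x e) (hn : #F ≤ 113) {w : α}
    (hwx : w ≠ x) {i : Fin 5} (hv : Varies F e w i) : #(forcedIndices F e w) ≤ 1 := by
  by_contra! hQ
  -- With `n ≤ 113` the pair count gives `3K ≥ 135 - 6 - 113 = 16`, so `K ≥ 6`.
  have hpair : ∀ u ∈ forcedIndices F e w, ∀ v ∈ forcedIndices F e w, u ≠ v →
      6 ≤ #{A ∈ F | indexTrace e A = {u, v} ∧ w ∉ A} := by
    intro u hu v hv' huv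
    have hiu : i ≠ u := fun hiu => hv.notMem (hiu ▸ hu)
    have hiv : i ≠ v := fun hiv => hv.notMem (hiv ▸ hv')
    obtain ⟨h1, h2⟩ := sum_forced_pair_five i u v hiu hiv huv
    have h4 := h.weight_forced_pair_le hwx hv hu hv'
    rw [h1, h2] at h4
    omega
  have h1 := h.weight_univ_le (fun T => if #T = 2 ∧ T ⊆ forcedIndices F e w then 7
      else if #(T ∩ forcedIndices F e w) = 2 then 2
        else if i ∈ T ∧ T ∩ forcedIndices F e w = ∅ then 2 else 1) fun T hT => by
    split_ifs with hc₁ hc₂ hc₃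
    · obtain ⟨u, v, huv, rfl⟩ := card_eq_two.1 hc₁.1
      have hu := hc₁.2 (mem_insert_self u {v})
      have := hpair u hu v (hc₁.2 (by simp)) huv
      have := h.traceCount_forced_pair_ge (v := v) hu
      omega
    · obtain ⟨u, v, huv, hTQ⟩ := card_eq_two.1 hc₂
      have hu : u ∈ T ∩ forcedIndices F e w := by simp [hTQ]
      have hv' : v ∈ T ∩ forcedIndices F e w := by simp [hTQ]
      have := hpair u (mem_inter.1 hu).2 v (mem_inter.1 hv').2 huv
      have h2 := h.two_le_traceCount_insert_pair (v := v) (mem_inter.1 hu).2 (by omega)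
        (sdiff_disjoint : Disjoint (T \ forcedIndices F e w) _)
      rwa [← hTQ, union_comm, sdiff_union_inter] at h2
    · exact h.two_le_traceCount_of_disjoint hv hc₃.1 (disjoint_iff_inter_eq_empty.2 hc₃.2)
    · exact h.one_le_traceCount hT
  have h2 := sum_forced_five i (forcedIndices F e w) hv.notMem hQ
  rw [Fintype.card_fin] at h1
  omega

lemma three_le_traceCount_five {e : Fin 5 → α} (h : IsCross F x e) (hn : #F ≤ 113) (z : Fin 5) :
    3 ≤ traceCount F e {z} := by
  by_contra! hz
  -- If every singleton trace occurred at most twice, counting with threshold `2` would give `69 +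
  -- 6n ≤ 5n + 42`.
  obtain ⟨y, hy⟩ : ∃ y, 3 ≤ traceCount F e {y} := by
    by_contra! hall
    have h1 := h.weight_le univ 2 (fun _ => 1) fun T hT => h.one_le_traceCount hT
    have h2 : ∑ T : Finset (Fin 5), (2 - #(T ∩ univ)) * traceCount F e T
        ≤ ∑ T : Finset (Fin 5), (2 - #(T ∩ univ)) * 2 := by
      refine sum_le_sum fun T _ => ?_
      rw [inter_univ]
      rcases T.eq_empty_or_nonempty with rfl | hT
      · exact Nat.mul_le_mul_left _ h.traceCount_empty_le
      · by_cases hT1 : #T = 1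
        · obtain ⟨j, rfl⟩ := card_eq_one.1 hT1
          exact Nat.mul_le_mul_left _ (by have := hall j; omega)
        · have := card_pos.2 hT
          rw [show 2 - #T = 0 by omega, zero_mul, zero_mul]
    have h3 : ∑ T : Finset (Fin 5), (2 - #(T ∩ univ)) * 2 = 14 := by decide +kernel
    have h4 : ∑ T : Finset (Fin 5), (#(T ∩ univ) - 2) * 1 = 23 := by decide +kernel
    rw [h4, card_univ, Fintype.card_fin] at h1
    omega
  have hyz : y ≠ z := by rintro rfl; omega
  obtain ⟨w, hwx, hv⟩ := exists_varies hy x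
  obtain ⟨g, hgy, hg⟩ : ∃ g, g ≠ y ∧
      ∀ T : Finset (Fin 5), y ∈ T → g ∉ T → 2 ≤ traceCount F e T := by
    obtain ⟨k, hk⟩ := card_le_one_iff_subset_singleton.1 (h.forced_subset_singleton_five hn hwx hv)
    by_cases hky : k = y
    · obtain ⟨k', hk'⟩ := exists_ne y
      refine ⟨k', hk', fun T hyT _ => h.two_le_traceCount_of_disjoint hv hyT ?_⟩
      refine disjoint_left.2 fun l _ hlQ => hv.notMem ?_
      rwa [← hky, ← mem_singleton.1 (hk hlQ)]
    · exact ⟨k, hky, fun T hyT hkT => h.two_le_traceCount_of_disjoint hv hyT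
        (disjoint_left.2 fun l hl hlQ => hkT (mem_singleton.1 (hk hlQ) ▸ hl))⟩
  -- The count off `z` reads `3 * 42 + 3n ≤ 4n + 12`, so `n ≥ 114`.
  have h1 := h.weight_le (univ.erase z) 1 (fun T => if y ∈ T ∧ g ∉ T then 2 else 1)
    fun T hT => by
      split_ifs with hc
      · exact hg T hc.1 hc.2
      · exact h.one_le_traceCount hT
  have h2 := h.sum_erase_traceCount_le (z := z) (by omega)
  have h3 := sum_erase_five z y g hyz hgy
  have h4 : #((univ : Finset (Fin 5)).erase z) = 4 := by simp
  rw [h4] at h1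
  omega

/-- Weight `78` gives `2n ≥ 3 * 78 - 6 = 228`. -/
theorem card_ge_of_five {e : Fin 5 → α} (h : IsCross F x e) : 114 ≤ #F := by
  by_contra! hn
  have hn : #F ≤ 113 := by omega
  obtain ⟨g, hg, hgT⟩ := h.exists_map (h.three_le_traceCount_five hn)
    fun w j hw hv => h.forced_subset_singleton_five hn hw hv
  have h1 := h.weight_univ_le (fun T => if ∃ j ∈ T, g j ∉ T then 2 else 1) fun T hT => by
    split_ifs with hc
    · obtain ⟨j, hj, hjT⟩ := hc
      exact hgT j T hj hjT
    · exact h.one_le_traceCount hT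
  have h2 := sum_not_closed_five g hg
  rw [Fintype.card_fin] at h1
  omega

theorem card_ge_of_six {e : Fin 6 → α} (h : IsCross F x e) : 127 ≤ #F := by
  have h1 := h.weight_univ_le (fun _ => 1) fun T hT => h.one_le_traceCount hT
  have h2 : ∑ T : Finset (Fin 6), (#T - 1) * 1 = 129 := by decide +kernel
  rw [h2, Fintype.card_fin] at h1
  omega

theorem card_ge_of_seven_le {s : ℕ} {e : Fin s → α} (h : IsCross F x e) (hs : 7 ≤ s) :
    127 ≤ #F := by
  have h1 : ∑ T : Finset (Fin s), (if T = ∅ then 0 else 1) ≤ #F := by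
    rw [← sum_traceCount F e]
    refine sum_le_sum fun T _ => ?_
    split_ifs with hT
    · exact Nat.zero_le _
    · exact h.one_le_traceCount (nonempty_iff_ne_empty.2 hT)
  have h2 : ∑ T : Finset (Fin s), (if T = ∅ then 0 else 1) + 1 = 2 ^ s := by
    have h3 : ∑ T : Finset (Fin s), (if T = ∅ then 1 else 0) = 1 := by simp
    nth_rewrite 2 [← h3]
    rw [← sum_add_distrib, sum_congr rfl (g := fun _ => 1) fun T _ => by split_ifs <;> rfl]
    simp
  have h4 : 2 ^ 7 ≤ 2 ^ s := Nat.pow_le_pow_right (by norm_num) hs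
  omega

theorem false_of_three {e : Fin 3 → α} (h : IsCross F x e) : False := by
  have h1 := h.weight_univ_le (fun _ => 1) fun T hT => h.one_le_traceCount hT
  have h2 : ∑ T : Finset (Fin 3), (#T - 1) * 1 = 5 := by decide +kernel
  rw [h2, Fintype.card_fin] at h1
  omega

theorem false_of_two {e : Fin 2 → α} (h : IsCross F x e) : False := by
  have h1 := h.weight_univ_le (fun _ => 1) fun T hT => h.one_le_traceCount hT
  have h2 : ∑ T : Finset (Fin 2), (#T - 1) * 1 = 1 := by decide +kernel
  -- The general count gives only `n ≤ 3`; the single point `0` lies in two traces, so its frequency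
  -- bound gives `n ≥ 6`.
  have h3 := h.weight_le {0} 0 (fun _ => 1) fun T hT => h.one_le_traceCount hT
  have h4 : ∑ T : Finset (Fin 2), (#(T ∩ {0}) - 0) * 1 = 2 := by decide +kernel
  rw [h2, Fintype.card_fin] at h1
  rw [h4] at h3
  simp at h3
  omega

/-- At most two members avoid the point, and at most a third contain it; with at least one
containing it, the counts must be exactly `2` and `1`. -/
theorem isNearTwoCube_of_one {e : Fin 1 → α} (h : IsCross F x e) : IsNearTwoCube F := by
  have h1 : 3 * setCount F (e 0) ≤ #F := h.count_le _ (h.ne_apex 0)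
  have hsplit : setCount F (e 0) + #{A ∈ F | e 0 ∉ A} = #F := card_filter_add_card_filter_not _
  have hsub : {A ∈ F | e 0 ∉ A} ⊆ {∅, {x}} := by
    intro A hA
    obtain ⟨hA, h0⟩ := mem_filter.1 hA
    by_contra hne
    simp only [mem_insert, mem_singleton, not_or] at hne
    obtain ⟨i, hi⟩ := h.meets A hA hne.1 hne.2
    rw [mem_indexTrace, Subsingleton.elim i 0] at hi
    exact h0 hi
  have hle := (card_le_card hsub).trans card_le_two
  obtain ⟨U, hU, hUe⟩ := h.priv 0
  have hUe : e 0 ∈ U := by rw [← mem_indexTrace (e := e), hUe]; exact mem_singleton_self _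
  have hpos : 0 < setCount F (e 0) := card_pos.2 ⟨U, mem_filter.2 ⟨hU, hUe⟩⟩
  have hone : setCount F (e 0) = 1 := by omega
  have heq : {A ∈ F | e 0 ∉ A} = {∅, {x}} :=
    eq_of_subset_of_card_le hsub (card_le_two.trans (by omega))
  have hfil : {A ∈ F | e 0 ∈ A} = {U} := by
    obtain ⟨V, hV⟩ := card_eq_one.1 hone
    have : U ∈ ({V} : Finset (Finset α)) := hV ▸ mem_filter.2 ⟨hU, hUe⟩
    rw [hV, mem_singleton.1 this]
  have hxF : {x} ∈ F := by
    have : {x} ∈ {A ∈ F | e 0 ∉ A} := by rw [heq]; simp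
    exact (mem_filter.1 this).1
  have hxU : {x} ⊆ U := by
    have : {x} ∪ U ∈ {A ∈ F | e 0 ∈ A} :=
      mem_filter.2 ⟨h.union_mem _ hxF _ hU, mem_union_right _ hUe⟩
    rw [hfil, mem_singleton] at this
    exact this ▸ subset_union_left
  refine ⟨x, U, hxU.ssubset_of_ne fun hx => h.ne_apex 0 ?_, ?_⟩
  · rw [← hx] at hUe
    exact mem_singleton.1 hUe
  · rw [← filter_union_filter_not_eq (fun A => e 0 ∈ A) F, hfil, heq]
    ext A
    simp only [mem_union, mem_insert, mem_singleton]
    tauto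

theorem card_groundSet_le_of_zero {e : Fin 0 → α} (h : IsCross F x e) : #(groundSet F) ≤ 1 := by
  refine (card_le_card (t := {x}) fun y hy => ?_).trans (card_singleton x).le
  obtain ⟨A, hA, hy⟩ := mem_biUnion.1 hy
  by_contra hyx
  obtain ⟨i, -⟩ := h.meets A hA (ne_empty_of_mem hy) (by rintro rfl; exact hyx hy)
  exact i.elim0

theorem card_and_index {s : ℕ} {e : Fin s → α} (h : IsCross F x e) (hground : 2 ≤ #(groundSet F))
    (hcube : ¬ IsNearTwoCube F) (hn : #F ≤ 113) : 81 ≤ #F ∧ s = 4 := by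
  rcases le_or_gt 7 s with hs | hs
  · have := h.card_ge_of_seven_le hs
    omega
  interval_cases s
  · have := h.card_groundSet_le_of_zero
    omega
  · exact absurd h.isNearTwoCube_of_one hcube
  · exact h.false_of_two.elim
  · exact h.false_of_three.elim
  · exact ⟨h.card_ge_of_four, rfl⟩
  · have := h.card_ge_of_five
    omega
  · have := h.card_ge_of_six
    omega

end IsCross

/-! ### From the frequency hypothesis to the main theorem. -/

section Main

variable {α : Type*} [DecidableEq α] {F : Finset (Finset α)} {x : α}

/-- All elements other than a most frequent one are at most as frequent as the second one. -/
lemma setCount_le_of_kthFrequency_le (hground : 2 ≤ #(groundSet F))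
    (hfreq : kthFrequency 2 F ≤ 1 / 3) (hx : IsMostFrequent F x) {y : α} (hy : y ≠ x) :
    3 * setCount F y ≤ #F := by
  by_cases hyG : y ∈ groundSet F
  swap
  · have : setCount F y = 0 := card_eq_zero.2 (filter_eq_empty_iff.2 fun A hA hyA =>
      hyG (mem_biUnion.2 ⟨A, hA, hyA⟩))
    omega
  have hcoe : ((sortedCounts F : List ℕ) : Multiset ℕ) = (groundSet F).val.map (setCount F) :=
    Multiset.sort_eq _ _
  have hsorted : (sortedCounts F).Pairwise (· ≥ ·) := Multiset.pairwise_sort _ _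
  obtain ⟨a, b, l, hl⟩ : ∃ a b l, sortedCounts F = a :: b :: l := by
    have hlen : (sortedCounts F).length = #(groundSet F) := by
      rw [← Multiset.coe_card, hcoe, Multiset.card_map]; rfl
    match hm : sortedCounts F with
    | [] => rw [hm] at hlen; simp at hlen; omega
    | [a] => rw [hm] at hlen; simp at hlen; omega
    | a :: b :: l => exact ⟨a, b, l, rfl⟩
  have hFpos : 0 < #F := by
    obtain ⟨A, hA, -⟩ := mem_biUnion.1 hyG
    exact card_pos.2 ⟨A, hA⟩
  have hb : 3 * b ≤ #F := by
    simp only [kthFrequency, hl] at hfreq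
    rw [div_le_div_iff₀ (by exact_mod_cast hFpos) (by norm_num)] at hfreq
    simp at hfreq
    have : b * 3 ≤ #F := by exact_mod_cast hfreq
    omega
  have hyb : setCount F y ≤ b := by
    by_contra! hlt
    rw [hl] at hcoe hsorted
    -- Only the head of the sorted list can exceed the second entry `b`, whereas both `x` and `y`
    -- would.
    have h1 : Multiset.countP (b < ·) ((a :: b :: l : List ℕ) : Multiset ℕ) ≤ 1 := by
      rw [Multiset.coe_countP, List.countP_cons]
      have : List.countP (fun c => decide (b < c)) (b :: l) = 0 := by
        rw [List.countP_eq_zero]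
        intro c hc
        have hbl := (List.pairwise_cons.1 hsorted).2
        rcases List.mem_cons.1 hc with rfl | hc
        · simp
        · simpa using (List.pairwise_cons.1 hbl).1 c hc
      rw [this]
      split_ifs <;> omega
    rw [hcoe, Multiset.countP_map] at h1
    have h2 : ({x, y} : Finset α) ⊆ (groundSet F).filter (fun z => b < setCount F z) := by
      intro z hz
      rcases mem_insert.1 hz with rfl | hz
      · exact mem_filter.2 ⟨hx.1, hlt.trans_le (hx.2 y hyG)⟩
      · rw [mem_singleton.1 hz]
        exact mem_filter.2 ⟨hyG, hlt⟩
    have h3 := card_le_card h2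
    rw [card_pair hy.symm] at h3
    exact absurd (h3.trans h1) (by norm_num)
  omega

/-- Deleting a point of `S` destroys goodness, so some member other than `∅` and `{x}` meets `S` in
that point alone. -/
lemma IsMinimalTwoGood.isCross (hF : ∀ A ∈ F, ∀ B ∈ F, A ∪ B ∈ F)
    (hcnt : ∀ y, y ≠ x → 3 * setCount F y ≤ #F) {S : Finset α} (hS : IsMinimalTwoGood F x S) :
    IsCross F x (fun i => (S.equivFin.symm i : α)) := by
  obtain ⟨⟨hxS, hmeet⟩, hmin⟩ := hS
  refine ⟨hF, hcnt, fun i hi => hxS (hi ▸ (S.equivFin.symm i).2), fun A hA h0 hx => ?_, fun i => ?_⟩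
  · obtain ⟨y, hy⟩ := nonempty_iff_ne_empty.2 (hmeet A hA h0 hx)
    obtain ⟨hyS, hyA⟩ := mem_inter.1 hy
    exact ⟨S.equivFin ⟨y, hyS⟩, by simpa using hyA⟩
  · set y : α := ((S.equivFin.symm i : S) : α)
    have hyS : y ∈ S := (S.equivFin.symm i).2
    have hng := hmin _ (erase_ssubset hyS)
    simp only [IsTwoGood, not_and, not_forall, not_not] at hng
    obtain ⟨A, hA, h0, hx, hd⟩ := hng fun h => hxS (mem_of_mem_erase h)
    refine ⟨A, hA, ?_⟩
    have hmem : ∀ z ∈ S, z ∈ A → z = y := by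
      intro z hzS hzA
      by_contra hzy
      have : z ∈ S.erase y ∩ A := mem_inter.2 ⟨mem_erase.2 ⟨hzy, hzS⟩, hzA⟩
      simp [hd] at this
    obtain ⟨z, hz⟩ := nonempty_iff_ne_empty.2 (hmeet A hA h0 hx)
    obtain ⟨hzS, hzA⟩ := mem_inter.1 hz
    ext j
    rw [mem_indexTrace, mem_singleton]
    constructor
    · intro hj
      have := hmem _ (S.equivFin.symm j).2 hj
      exact S.equivFin.symm.injective (Subtype.ext this)
    · intro hji
      rw [hji]
      rwa [hmem z hzS hzA] at hzA

lemma exists_isMinimalTwoGood (F : Finset (Finset α)) (x : α) :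
    ∃ S, IsMinimalTwoGood F x S := by
  classical
  have hgood : IsTwoGood F x ((groundSet F).erase x) := by
    refine ⟨notMem_erase _ _, fun A hA h0 hx hd => ?_⟩
    have hsub : A ⊆ {x} := by
      intro y hy
      by_contra hyx
      have : y ∈ (groundSet F).erase x ∩ A := mem_inter.2
        ⟨mem_erase.2 ⟨fun h => hyx (mem_singleton.2 h), mem_biUnion.2 ⟨A, hA, hy⟩⟩, hy⟩
      simp [hd] at this
    exact (subset_singleton_iff.1 hsub).elim h0 hx
  obtain ⟨S, hS, hmin⟩ := exists_min_image
    (((groundSet F).erase x).powerset.filter (IsTwoGood F x)) card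
    ⟨_, mem_filter.2 ⟨mem_powerset_self _, hgood⟩⟩
  obtain ⟨hSG, hS⟩ := mem_filter.1 hS
  refine ⟨S, hS, fun T hT hTgood => ?_⟩
  have := hmin T (mem_filter.2 ⟨mem_powerset.2 (hT.subset.trans (mem_powerset.1 hSG)), hTgood⟩)
  exact absurd (card_lt_card hT) (not_lt.2 this)

lemma exists_isMostFrequent (h : (groundSet F).Nonempty) : ∃ x, IsMostFrequent F x :=
  exists_max_image (groundSet F) (setCount F) h

end Main

theorem mainTheorem1 {α : Type*} [DecidableEq α] (F : Finset (Finset α))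
    (hF : ∀ A ∈ F, ∀ B ∈ F, A ∪ B ∈ F)
    (hground : 2 ≤ #(groundSet F))
    (hcube : ¬ IsNearTwoCube F)
    (hfreq : kthFrequency 2 F ≤ 1 / 3) :
    (81 ≤ #F ∧ #F ≤ 113) ∧
      ∀ x : α, IsMostFrequent F x → ∀ S : Finset α, IsMinimalTwoGood F x S → #S = 4 := by
  have hcnt : ∀ x, IsMostFrequent F x → ∀ y, y ≠ x → 3 * setCount F y ≤ #F :=
    fun x hx y hy => setCount_le_of_kthFrequency_le hground hfreq hx hy
  have hle : ∀ x, IsMostFrequent F x → #F ≤ 113 :=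
    fun x hx => card_le_of_setCount_le hF hx.1 (hcnt x hx)
  have hcross : ∀ x, IsMostFrequent F x → ∀ S, IsMinimalTwoGood F x S → 81 ≤ #F ∧ #S = 4 :=
    fun x hx S hS => (hS.isCross hF (hcnt x hx)).card_and_index hground hcube (hle x hx)
  obtain ⟨x, hx⟩ := exists_isMostFrequent (F := F) (card_pos.1 (by omega))
  obtain ⟨S, hS⟩ := exists_isMinimalTwoGood F x
  exact ⟨⟨(hcross x hx S hS).1, hle x hx⟩, fun x hx S hS => (hcross x hx S hS).2⟩
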